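/- Let $H$ be a separable infinite-dimensional complex Hilbert space, let $c$ be a bounded operator on $H$, and let $N$ be the von Neumann algebra generated by $c$ and the identity. Suppose that $\tau$ is a faithful normal tracial state on $N$ (so $N$ is finite), and let $$B=\{(\tau(a),\tau(ac)) : a\in N,\ 0\le a\le 1\}\subset\mathbb R\times\mathbb C$$ be the spectral scale of $c$ relative to $\tau$. Let $W(c)=\{\langle cx,x\rangle : \|x\|=1\}$ be the numerical range of $c$ and $W_{ab}(c)=\{f(c) : f \text{ a state on } C^*(c,1)\}$ its abstract numerical range. A face of a convex set $A$ is a convex subset $F\subseteq A$ that contains both end points of every open segment of $A$ which meets $F$; dimensions are real affine dimensions, and line segments are closed and nondegenerate. Let $F_{ab}$ be a proper one-dimensional face of $W_{ab}(c)$, that is, $F_{ab}\ne W_{ab}(c)$, and put $F_W=F_{ab}\cap W(c)$. Then $F_W$ is one-dimensional if and only if $B$ has a two-dimensional face $F_B$ containing the origin such that every line segment in $F_B$ that contains the origin is of the form $\{(t,t\lambda) : 0\le t\le s\}$ with $\lambda\in F_W$ and $s>0$. Moreover, for every such face $F_B$ the following holds. For each $\lambda\in F_W$ the number $t_\lambda=\max\{t\in\mathbb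 R : (t,t\lambda)\in B\}$ exists and is positive, and the line segments in $F_B$ that contain the origin are exactly the segments $\{(t,t\lambda) : 0\le t\le s\}$ with $\lambda\in F_W$ and $0<s\le t_\lambda$. -/

import Mathlib

namespace SpectralScale

/-- The affine dimension of a subset of a real vector space. -/
noncomputable def affineDim {E : Type*} [AddCommGroup E] [Module ℝ E] (S : Set E) : ℕ :=
  Module.finrank ℝ (vectorSpan ℝ S)

/-- `F` is a face of the convex set `A`: a convex subset of `A` that contains both end points of
every open segment of `A` which it meets. -/
def IsFace {E : Type*} [AddCommGroup E] [Module ℝ E] (A F : Set E) : Prop :=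
  Convex ℝ F ∧ IsExtreme ℝ A F

/-- A nondegenerate closed line segment. -/
def IsLineSegment {E : Type*} [AddCommGroup E] [Module ℝ E] (S : Set E) : Prop :=
  ∃ x y : E, x ≠ y ∧ S = segment ℝ x y

/-- The segment `{(t, t * lam) : 0 ≤ t ≤ s}`, which starts at the origin and has complex slope
`lam`. -/
def radialSegment (lam : ℂ) (s : ℝ) : Set (ℝ × ℂ) :=
  {p | ∃ t : ℝ, 0 ≤ t ∧ t ≤ s ∧ p = (t, (t : ℂ) * lam)}

open scoped ComplexOrder in
/-- A state on a unital complex star algebra (applied here to operator algebras): a linear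
functional that is positive on all elements `a* a` and takes the value `1` at `1`. -/
structure IsState {A : Type*} [Ring A] [StarRing A] [Algebra ℂ A] (f : A →ₗ[ℂ] ℂ) : Prop where
  nonneg : ∀ a : A, 0 ≤ f (star a * a)
  map_one : f 1 = 1

section Operators

variable {H : Type*} [NormedAddCommGroup H] [InnerProductSpace ℂ H] [CompleteSpace H]

/-- The numerical range of `c`. (Mathlib's inner product is linear in its second argument.) -/
def numRange (c : H →L[ℂ] H) : Set ℂ :=
  {z | ∃ x : H, ‖x‖ = 1 ∧ inner ℂ x (c x) = z}

/-- The abstract numerical range of `c`: the values at `c` of the states on the C*-algebra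
generated by `c` and the identity. -/
def abstractNumRange (c : H →L[ℂ] H) : Set ℂ :=
  {z | ∃ f : StarAlgebra.elemental ℂ c →ₗ[ℂ] ℂ,
    IsState f ∧ f ⟨c, StarAlgebra.elemental.self_mem ℂ c⟩ = z}

/-- The von Neumann algebra generated by `c` (and the identity): the double commutant of
`{c, c*}`. -/
noncomputable def vonNeumann (c : H →L[ℂ] H) : VonNeumannAlgebra H where
  toStarSubalgebra :=
    StarSubalgebra.centralizer ℂ (StarSubalgebra.centralizer ℂ {c} : Set (H →L[ℂ] H))
  centralizer_centralizer' := by simp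

theorem self_mem_vonNeumann (c : H →L[ℂ] H) : c ∈ (vonNeumann c).toStarSubalgebra := by
  change c ∈ StarSubalgebra.centralizer ℂ (StarSubalgebra.centralizer ℂ {c} : Set (H →L[ℂ] H))
  rw [StarSubalgebra.mem_centralizer_iff]
  intro g hg
  have h1 := (StarSubalgebra.mem_centralizer_iff ℂ).1 hg c rfl
  have h2 := (StarSubalgebra.mem_centralizer_iff ℂ).1 (star_mem hg) c rfl
  exact ⟨h1.1.symm, h2.1.symm⟩

/-- The order-theoretic definition of normality: `τ` preserves least upper bounds of increasing
nets of self-adjoint elements, the order being the usual one on operators. -/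
def IsNormal {N : StarSubalgebra ℂ (H →L[ℂ] H)} (τ : N →ₗ[ℂ] ℂ) : Prop :=
  ∀ (D : Set N) (a : N), D.Nonempty → (∀ x ∈ D, IsSelfAdjoint x) → DirectedOn (· ≤ ·) D →
    IsLUB D a → IsLUB ((fun x : N => (τ x).re) '' D) (τ a).re

/-- A faithful normal tracial state on the algebra `N`. -/
structure IsFaithfulNormalTracialState {N : StarSubalgebra ℂ (H →L[ℂ] H)}
    (τ : N →ₗ[ℂ] ℂ) : Prop where
  isState : IsState τ
  faithful : ∀ a : N, τ (star a * a) = 0 → a = 0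
  normal : IsNormal τ
  tracial : ∀ a b : N, τ (a * b) = τ (b * a)

/-- The spectral scale of `c` relative to `τ`: the set of all `(τ(a), τ(a c))` with `a` in the
von Neumann algebra generated by `c` and `0 ≤ a ≤ 1`. (For a state `τ` and `0 ≤ a` the number
`τ(a)` is real.) -/
def spectralScale (c : H →L[ℂ] H) (τ : (vonNeumann c).toStarSubalgebra →ₗ[ℂ] ℂ) :
    Set (ℝ × ℂ) :=
  {p | ∃ a : (vonNeumann c).toStarSubalgebra,
    0 ≤ (a : H →L[ℂ] H) ∧ (a : H →L[ℂ] H) ≤ 1 ∧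
      p = ((τ a).re, τ (a * ⟨c, self_mem_vonNeumann c⟩))}

end Operators

end SpectralScale

/-!
# Faces of the spectral scale at the origin and one-dimensional faces of the numerical range

A proper one-dimensional face `Fab` of the abstract numerical range is cut out by a supporting
line `f z = u` with `f z = Re (w z)` (`IsFace.exists_supporting_line`). Then `u - Re (w c) ≥ 0`,
and for the projection `p` onto its kernel, which lies in the von Neumann algebra of `c`, the set
`FW = Fab ∩ W(c)` is the numerical range of the compression of `c` to the range of `p`. In the
same way faithfulness of the trace shows that the points `(t, z)` of the spectral scale `B`
satisfy `f z ≤ u t`, with equality exactly for the points `(τ(a), τ(a c))` with `0 ≤ a ≤ p`. These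
points form a face `E` of `B` which contains the origin and lies in a plane.

Two facts link `E` with `FW`. Slopes of nonzero points of `E` lie in `FW`
(`mem_numRange_of_mem_spectralScale`): on the range of `p` only `d = Im (w c)` matters, and if
`τ(a d) = μ τ(a)` for some nonzero `a` but `μ` is not a value of the quadratic form of `d` on unit
vectors in the range of `p`, then `d - μ` is definite there by the intermediate value theorem,
which faithfulness forbids. Conversely, for every slope in `FW` there is a furthest point of `E`
with that slope, and it is not the origin (`exists_isGreatest`): one has to maximize `τ(a)` over
`0 ≤ a ≤ p` subject to the single linear constraint `τ(a (d - μ)) = 0`. As in the Neyman–Pearson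
lemma the maximum is attained by cutting the spectrum of `d - μ` at a threshold
(`exists_isMaximizer`). Normality of the trace is used only to find the threshold. The spectral
projections involved are projections onto kernels of continuous functions of the operator, so no
Borel functional calculus is needed.

The rest is plane geometry (`faces_over_supporting_line`). If `FW` has two points, `E` is
two-dimensional and its segments through the origin have slopes in `FW`. Conversely, a face of `B`
whose segments through the origin have slopes in `FW` is contained in `E`, and if it is
two-dimensional it equals `E`.
-/

namespace SpectralScale

/-! ### Faces of convex sets -/

section ConvexSets

variable {E : Type*} [NormedAddCommGroup E] [NormedSpace ℝ E] [FiniteDimensional ℝ E]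

theorem mem_openSegment_of_extend {E : Type*} [AddCommGroup E] [Module ℝ E] {x y : E} {ε : ℝ}
    (hε : 0 < ε) : x ∈ openSegment ℝ y ((-ε) • (y - x) + x) := by
  refine ⟨ε / (1 + ε), 1 / (1 + ε), by positivity, by positivity, ?_, ?_⟩
  · field_simp
    ring
  · have h1 : (1 + ε : ℝ) ≠ 0 := by positivity
    match_scalars <;> field_simp <;> ring

theorem IsFace.mono {E : Type*} [AddCommGroup E] [Module ℝ E] {A B F : Set E}
    (h : IsFace A F) (hBA : B ⊆ A) (hFB : F ⊆ B) : IsFace B F :=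
  ⟨h.1, h.2.mono hBA hFB⟩

/-- A face spanning the same directions as the whole set contains a relative interior point of the
set, hence is all of it. -/
theorem IsFace.eq_of_vectorSpan_le {A F : Set E} (h : IsFace A F) (hne : F.Nonempty)
    (hspan : vectorSpan ℝ A ≤ vectorSpan ℝ F) : F = A := by
  refine h.2.1.antisymm fun y hy => ?_
  obtain ⟨x, hx⟩ := hne.intrinsicInterior h.1
  have hxF : x ∈ F := intrinsicInterior_subset hx
  have hv : y - x ∈ (affineSpan ℝ F).direction := by
    rw [direction_affineSpan]
    exact hspan (vsub_mem_vectorSpan ℝ hy (h.2.1 hxF))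
  obtain ⟨z, hz, rfl⟩ := mem_intrinsicInterior.1 hx
  -- a point slightly beyond `z`, seen from `y`, stays in `F`
  let g : ℝ → affineSpan ℝ F := fun t => ⟨(-t) • (y - (z : E)) + (z : E),
    AffineSubspace.vadd_mem_of_mem_direction (Submodule.smul_mem _ _ hv) z.2⟩
  have hg : Continuous g := by
    refine Continuous.subtype_mk ?_ _
    fun_prop
  have hg0 : g 0 = z := by ext; simp [g]
  have hev : ∀ᶠ t in nhds (0 : ℝ), g t ∈ interior ((↑) ⁻¹' F : Set (affineSpan ℝ F)) := by
    apply hg.continuousAt.eventually_mem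
    rw [hg0]
    exact isOpen_interior.mem_nhds hz
  obtain ⟨ε, hε, hball⟩ := Metric.eventually_nhds_iff.1 hev
  have hw : g (ε / 2) ∈ ((↑) ⁻¹' F : Set (affineSpan ℝ F)) :=
    interior_subset (hball (y := ε / 2) (by
      rw [Real.dist_eq, sub_zero, abs_of_pos (by positivity)]; linarith))
  refine h.2.2 hy (h.2.1 hw) hxF (mem_openSegment_of_extend (half_pos hε))

theorem IsFace.eq_of_affineDim_le {A F : Set E} (h : IsFace A F) (hne : F.Nonempty)
    (hdim : affineDim A ≤ affineDim F) : F = A :=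
  h.eq_of_vectorSpan_le hne
    (Submodule.eq_of_le_of_finrank_le (vectorSpan_mono ℝ h.2.1) hdim).ge

omit [FiniteDimensional ℝ E] in
/-- Every point of `A` is an end point of an open segment of `A` through a given interior point. -/
theorem IsFace.disjoint_interior {A F : Set E} (h : IsFace A F) (hF : F ≠ A) :
    Disjoint (interior A) F := by
  rw [Set.disjoint_left]
  intro x hx hxF
  refine hF (h.2.1.antisymm fun y hy => ?_)
  let g : ℝ → E := fun t => (-t) • (y - x) + x
  have hg : Continuous g := by fun_prop
  have hev : ∀ᶠ t in nhds (0 : ℝ), g t ∈ interior A := by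
    apply hg.continuousAt.eventually_mem
    simpa [g] using isOpen_interior.mem_nhds hx
  obtain ⟨ε, hε, hball⟩ := Metric.eventually_nhds_iff.1 hev
  have hw : g (ε / 2) ∈ A := interior_subset (hball (y := ε / 2) (by
    rw [Real.dist_eq, sub_zero, abs_of_pos (by positivity)]; linarith))
  refine h.2.2 hy hw hxF (mem_openSegment_of_extend (half_pos hε))

theorem isFace_inter_level {E : Type*} [AddCommGroup E] [Module ℝ E] {A : Set E}
    (hA : Convex ℝ A) (f : E →ₗ[ℝ] ℝ) {u : ℝ} (hu : ∀ x ∈ A, f x ≤ u) :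
    IsFace A {x ∈ A | f x = u} := by
  refine ⟨fun x hx y hy a b ha hb hab => ⟨hA hx.1 hy.1 ha hb hab, ?_⟩, fun x hx => hx.1, ?_⟩
  · simp [hx.2, hy.2, ← add_mul, hab]
  · rintro x hx y hy z ⟨hz, hzu⟩ ⟨a, b, ha, hb, hab, rfl⟩
    refine ⟨hx, le_antisymm (hu x hx) ?_⟩
    simp only [map_add, map_smul, smul_eq_mul] at hzu
    have h2 := mul_le_mul_of_nonneg_left (hu y hy) hb.le
    have h1 : a * u ≤ a * f x := by
      obtain rfl : a = 1 - b := by linarith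
      linarith
    exact le_of_mul_le_mul_left h1 ha

theorem affineDim_ne_zero_iff {S : Set E} :
    affineDim S ≠ 0 ↔ ∃ x ∈ S, ∃ y ∈ S, x ≠ y := by
  rw [affineDim, Ne, Submodule.finrank_eq_zero, vectorSpan_eq_bot_iff_subsingleton,
    ← Set.not_nontrivial_iff, not_not]
  rfl

theorem vectorSpan_le_ker {E : Type*} [AddCommGroup E] [Module ℝ E] {S : Set E}
    (f : E →ₗ[ℝ] ℝ) {u : ℝ} (hu : ∀ x ∈ S, f x = u) : vectorSpan ℝ S ≤ LinearMap.ker f := by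
  rw [vectorSpan, Submodule.span_le]
  rintro _ ⟨x, hx, y, hy, rfl⟩
  simp [hu x hx, hu y hy]

/-- A proper one-dimensional face of a convex subset of the plane is cut out by a supporting
line. -/
theorem IsFace.exists_supporting_line {A F : Set ℂ} (hA : Convex ℝ A) (h : IsFace A F)
    (hF : F ≠ A) (hdim : affineDim F = 1) :
    ∃ (f : ℂ →ₗ[ℝ] ℝ) (u : ℝ), f ≠ 0 ∧ (∀ z ∈ A, f z ≤ u) ∧ F = {z ∈ A | f z = u} := by
  have hne : F.Nonempty := by
    obtain ⟨x, hx, -⟩ := affineDim_ne_zero_iff.1 (by rw [hdim]; exact one_ne_zero)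
    exact ⟨x, hx⟩
  -- otherwise `A` is at most one-dimensional, and a one-dimensional face exhausts it
  have hint : (interior A).Nonempty := by
    rw [hA.interior_nonempty_iff_affineSpan_eq_top]
    by_contra hcon
    refine hF (h.eq_of_affineDim_le hne ?_)
    rw [hdim]
    by_contra! hlt
    have h2 : Module.finrank ℝ (vectorSpan ℝ A) ≤ Module.finrank ℝ ℂ := Submodule.finrank_le _
    have h3 : vectorSpan ℝ A = ⊤ := Submodule.eq_top_of_finrank_eq (by
      rw [Complex.finrank_real_complex] at *
      unfold affineDim at hlt
      omega)
    exact hcon ((AffineSubspace.affineSpan_eq_top_iff_vectorSpan_eq_top_of_nonempty ℝ ℂ ℂ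
      (hne.mono h.2.1)).2 h3)
  obtain ⟨f, u, hlt, hge⟩ := geometric_hahn_banach_open hA.interior isOpen_interior h.1
    (h.disjoint_interior hF)
  have hle : ∀ z ∈ A, f z ≤ u := by
    have hsub : closure (interior A) ⊆ {z | f z ≤ u} :=
      closure_minimal (fun z hz => (hlt z hz).le) (isClosed_le f.continuous continuous_const)
    intro z hz
    refine hsub ?_
    rw [hA.closure_interior_eq_closure_of_nonempty_interior hint]
    exact subset_closure hz
  have hf : (f : ℂ →ₗ[ℝ] ℝ) ≠ 0 := by
    intro h0
    obtain ⟨x, hx⟩ := hint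
    obtain ⟨y, hy⟩ := hne
    have h1 : f x = 0 := LinearMap.congr_fun h0 x
    have h2 : f y = 0 := LinearMap.congr_fun h0 y
    have := hlt x hx
    have := hge y hy
    linarith
  refine ⟨f, u, hf, hle, ?_⟩
  have hsub : F ⊆ {z ∈ A | (f : ℂ →ₗ[ℝ] ℝ) z = u} :=
    fun z hz => ⟨h.2.1 hz, le_antisymm (hle z (h.2.1 hz)) (hge z hz)⟩
  refine (h.mono (fun z hz => hz.1) hsub).eq_of_affineDim_le hne ?_
  have h4 := Submodule.finrank_mono (vectorSpan_le_ker (f : ℂ →ₗ[ℝ] ℝ)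
    (fun z (hz : z ∈ {z ∈ A | (f : ℂ →ₗ[ℝ] ℝ) z = u}) => hz.2))
  have h5 := Module.Dual.finrank_ker_add_one_of_ne_zero hf
  rw [Complex.finrank_real_complex] at h5
  unfold affineDim at hdim ⊢
  omega

end ConvexSets

/-! ### Segments starting at the origin -/

section Segments

theorem radialSegment_eq (lam : ℂ) {s : ℝ} (hs : 0 < s) :
    radialSegment lam s = segment ℝ (0 : ℝ × ℂ) (s, s * lam) := by
  ext p
  rw [segment_eq_image]
  constructor
  · rintro ⟨t, h0, h1, rfl⟩
    refine ⟨t / s, ⟨by positivity, (div_le_one hs).2 h1⟩, ?_⟩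
    have : (s : ℂ) ≠ 0 := by exact_mod_cast hs.ne'
    ext <;> simp <;> field_simp
  · rintro ⟨θ, ⟨h0, h1⟩, rfl⟩
    refine ⟨θ * s, by positivity, by nlinarith, ?_⟩
    ext
    · simp
    · simp
      ring

theorem isLineSegment_radialSegment (lam : ℂ) {s : ℝ} (hs : 0 < s) :
    IsLineSegment (radialSegment lam s) :=
  ⟨0, (s, s * lam), fun h => hs.ne (congrArg Prod.fst h), radialSegment_eq lam hs⟩

theorem zero_mem_radialSegment (lam : ℂ) {s : ℝ} (hs : 0 < s) :
    (0 : ℝ × ℂ) ∈ radialSegment lam s := ⟨0, le_rfl, hs.le, by simp; rfl⟩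

theorem mem_radialSegment_end (lam : ℂ) {s : ℝ} (hs : 0 < s) :
    ((s, s * lam) : ℝ × ℂ) ∈ radialSegment lam s := ⟨s, hs.le, le_rfl, rfl⟩

/-- In a half-space touched only at the origin, a segment through the origin starts there. -/
theorem exists_eq_radialSegment {B S : Set (ℝ × ℂ)} (hB : ∀ p ∈ B, 0 ≤ p.1)
    (hB0 : ∀ p ∈ B, p.1 = 0 → p = 0) (hS : IsLineSegment S) (hSB : S ⊆ B) (h0 : 0 ∈ S) :
    ∃ (lam : ℂ) (s : ℝ), 0 < s ∧ S = radialSegment lam s := by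
  obtain ⟨x, y, hxy, rfl⟩ := hS
  have hx := hSB (left_mem_segment ℝ x y)
  have hy := hSB (right_mem_segment ℝ x y)
  have key : ∀ z ∈ B, z ≠ 0 →
      ∃ (lam : ℂ) (s : ℝ), 0 < s ∧ segment ℝ 0 z = radialSegment lam s := by
    intro z hz hz0
    have hpos : 0 < z.1 := (hB z hz).lt_of_ne fun h => hz0 (hB0 z hz h.symm)
    refine ⟨z.2 / z.1, z.1, hpos, ?_⟩
    have : (z.1 : ℂ) ≠ 0 := by exact_mod_cast hpos.ne'
    rw [radialSegment_eq _ hpos, mul_div_cancel₀ _ this]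
  obtain ⟨a, b, ha, hb, hab, habz⟩ := h0
  have h1 : a * x.1 + b * y.1 = 0 := by simpa using congrArg Prod.fst habz
  have hx1 := hB x hx
  have hy1 := hB y hy
  have h2 : a * x.1 = 0 := by nlinarith [mul_nonneg ha hx1, mul_nonneg hb hy1]
  have h3 : b * y.1 = 0 := by linarith
  by_cases hx0 : x = 0
  · subst hx0
    exact key y hy hxy.symm
  · have ha0 : a = 0 := (mul_eq_zero.1 h2).resolve_right fun h => hx0 (hB0 x hx h)
    have hy0 : y = 0 := hB0 y hy (by
      have : b = 1 := by linarith
      simpa [this] using h3)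
    subst hy0
    rw [segment_symm]
    exact key x hx hx0

end Segments

/-! ### Kernel projections and spectral projections -/

section Operators
variable {H : Type*} [NormedAddCommGroup H] [InnerProductSpace ℂ H] [CompleteSpace H]

/-- The orthogonal projection onto the kernel of `y`. -/
noncomputable def kerProj (y : H →L[ℂ] H) : H →L[ℂ] H := y.ker.starProjection

theorem isStarProjection_kerProj (y : H →L[ℂ] H) : IsStarProjection (kerProj y) :=
  isStarProjection_starProjection

theorem kerProj_apply_eq_self_iff {y : H →L[ℂ] H} {x : H} : kerProj y x = x ↔ y x = 0 := by
  rw [kerProj, Submodule.starProjection_eq_self_iff]; rfl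

theorem apply_kerProj (y : H →L[ℂ] H) (x : H) : y (kerProj y x) = 0 := by
  have : kerProj y x ∈ y.ker := Submodule.starProjection_apply_mem _ _
  exact this

theorem mul_kerProj (y : H →L[ℂ] H) : y * kerProj y = 0 := by
  ext x; exact apply_kerProj y x

theorem kerProj_mul_eq_self_iff {y a : H →L[ℂ] H} : kerProj y * a = a ↔ y * a = 0 := by
  simp only [ContinuousLinearMap.ext_iff, mul_apply_eq_comp, kerProj_apply_eq_self_iff,
    zero_apply]

/-- If `x` and `x*` both commute with `y`, both leave the kernel of `y` invariant, so `x` is reduced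
by it. -/
theorem commute_kerProj {x y : H →L[ℂ] H} (h : Commute x y) (h' : Commute (star x) y) :
    Commute x (kerProj y) := by
  have key : ∀ z : H →L[ℂ] H, Commute z y → kerProj y * (z * kerProj y) = z * kerProj y := by
    intro z hz
    rw [kerProj_mul_eq_self_iff, ← mul_assoc, ← hz.eq, mul_assoc, mul_kerProj, mul_zero]
  have h1 := key x h
  have h2 := congrArg star (key _ h')
  simp only [star_mul, star_star, (isStarProjection_kerProj y).isSelfAdjoint.star_eq] at h2
  rw [Commute, SemiconjBy, ← h1, ← h2, mul_assoc]

theorem apply_eq_zero_of_nonneg {x : H →L[ℂ] H} (hx : 0 ≤ x) {v : H}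
    (hv : (inner ℂ v (x v)).re = 0) : x v = 0 := by
  obtain ⟨s, hs, hs2⟩ : ∃ s : H →L[ℂ] H, IsSelfAdjoint s ∧ s * s = x :=
    ⟨CFC.sqrt x, (CFC.sqrt_nonneg x).isSelfAdjoint, CFC.sqrt_mul_sqrt_self x hx⟩
  have h3 : ‖s v‖ ^ 2 = 0 := by
    rw [← inner_self_eq_norm_sq (𝕜 := ℂ), ← ContinuousLinearMap.adjoint_inner_right,
      ← ContinuousLinearMap.star_eq_adjoint, hs.star_eq, ← mul_apply_eq_comp, hs2]
    exact hv
  have h4 : s v = 0 := by simpa using h3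
  rw [← hs2, mul_apply_eq_comp, h4, map_zero]

theorem kerProj_le_of_le {x y : H →L[ℂ] H} (hx : 0 ≤ x) (hxy : x ≤ y) : kerProj y ≤ kerProj x := by
  rw [kerProj, kerProj, Submodule.starProjection_le_starProjection_iff]
  intro v hv
  have hv' : y v = 0 := hv
  have h2 := ((ContinuousLinearMap.nonneg_iff_isPositive _).1 hx).re_inner_nonneg_right v
  have h1 := ((ContinuousLinearMap.le_def _ _).1 hxy).re_inner_nonneg_right v
  simp only [sub_apply, hv', zero_sub, inner_neg_right, map_neg] at h1
  exact apply_eq_zero_of_nonneg hx (le_antisymm (neg_nonneg.1 h1) h2)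

/-- The part `(k - s)₊` of a self-adjoint operator above the level `s`. The part `(s - k)₊` below
that level is `above (-k) (-s)`. -/
noncomputable def above (k : H →L[ℂ] H) (s : ℝ) : H →L[ℂ] H := cfc (fun x : ℝ => max (x - s) 0) k

theorem above_nonneg (k : H →L[ℂ] H) (s : ℝ) : 0 ≤ above k s :=
  cfc_nonneg fun _ _ => le_max_right _ _

theorem above_neg {k : H →L[ℂ] H} (hk : IsSelfAdjoint k) (s : ℝ) :
    above (-k) s = cfc (fun x : ℝ => max (-x - s) 0) k := by
  rw [above, ← cfc_comp_neg (fun x : ℝ => max (x - s) 0) k (by fun_prop)]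

theorem above_sub_above_neg {k : H →L[ℂ] H} (hk : IsSelfAdjoint k) (s : ℝ) :
    above k s - above (-k) (-s) = k - s • 1 := by
  rw [above_neg hk, above, ← cfc_sub .., ← Algebra.algebraMap_eq_smul_one]
  conv_rhs => rw [← cfc_id' ℝ k, ← cfc_const s k, ← cfc_sub ..]
  refine cfc_congr fun x _ => ?_
  rcases le_total x s with h | h
  · rw [max_eq_right (sub_nonpos.2 h), max_eq_left (by linarith : (0 : ℝ) ≤ -x - -s)]
    ring
  · rw [max_eq_left (sub_nonneg.2 h), max_eq_right (by linarith : -x - -s ≤ (0 : ℝ)), sub_zero]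

theorem above_mul_above_neg {k : H →L[ℂ] H} (hk : IsSelfAdjoint k) (s : ℝ) :
    above k s * above (-k) (-s) = 0 := by
  rw [above_neg hk, above, ← cfc_mul .., ← cfc_zero ℝ k]
  refine cfc_congr fun x _ => ?_
  rcases le_total x s with h | h
  · simp [max_eq_right (sub_nonpos.2 h)]
  · simp only [max_eq_right (by linarith : -x - -s ≤ (0 : ℝ)), mul_zero, Pi.zero_apply]

theorem above_antitone (k : H →L[ℂ] H) : Antitone (above k) := fun s t h =>
  cfc_mono fun x _ => max_le_max_right 0 (by linarith)

theorem norm_above_sub_le (k : H →L[ℂ] H) (s t : ℝ) :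
    ‖above k s - above k t‖ ≤ |s - t| := by
  rw [above, above, ← cfc_sub ..]
  refine norm_cfc_le (abs_nonneg _) fun x _ => ?_
  rw [Real.norm_eq_abs]
  refine (abs_max_sub_max_le_abs _ _ _).trans ?_
  rw [abs_sub_comm s t]
  exact le_of_eq (congrArg _ (by ring))

theorem above_norm (k : H →L[ℂ] H) : above k ‖k‖ = 0 := by
  rw [above, ← cfc_zero ℝ k]
  refine cfc_congr fun x hx => ?_
  have : x ≤ ‖k‖ := (le_abs_self x).trans <|
    (spectrum.norm_le_norm_mul_of_mem hx).trans <|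
      mul_le_of_le_one_right (norm_nonneg _) ContinuousLinearMap.norm_id_le
  simpa using this

theorem commute_above {k x : H →L[ℂ] H} (h : Commute k x) (s : ℝ) : Commute (above k s) x :=
  h.cfc_real _

/-- The spectral projection of `k` for the interval `(s, ∞)`: the projection onto the closure of
the range of `(k - s)₊`. The projection for `(-∞, s)` is `upperProj (-k) (-s)`. -/
noncomputable def upperProj (k : H →L[ℂ] H) (s : ℝ) : H →L[ℂ] H := 1 - kerProj (above k s)

theorem isStarProjection_upperProj (k : H →L[ℂ] H) (s : ℝ) : IsStarProjection (upperProj k s) :=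
  (isStarProjection_kerProj _).one_sub

theorem upperProj_antitone (k : H →L[ℂ] H) : Antitone (upperProj k) := fun _ t h =>
  sub_le_sub_left (kerProj_le_of_le (above_nonneg k t) (above_antitone k h)) 1

theorem commute_upperProj {k x : H →L[ℂ] H} (h : Commute k x) (h' : Commute k (star x)) (s : ℝ) :
    Commute (upperProj k s) x :=
  ((Commute.one_right x).sub_right
    (commute_kerProj (commute_above h s).symm (commute_above h' s).symm)).symm

theorem above_mul_upperProj (k : H →L[ℂ] H) (s : ℝ) : above k s * upperProj k s = above k s := by
  rw [upperProj, mul_sub, mul_one, mul_kerProj, sub_zero]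

theorem upperProj_norm (k : H →L[ℂ] H) : upperProj k ‖k‖ = 0 := by
  rw [upperProj, above_norm k, sub_eq_zero, eq_comm, ← mul_one (kerProj 0),
    kerProj_mul_eq_self_iff, zero_mul]

/-- The spectral projections for `(t, ∞)`, `t > s`, have that for `(s, ∞)` as their supremum: they
converge strongly to it, because `(k - t)₊` tends to `(k - s)₊` in norm. -/
theorem upperProj_le_of_forall_lt {k x : H →L[ℂ] H} {s : ℝ}
    (h : ∀ t, s < t → upperProj k t ≤ x) : upperProj k s ≤ x := by
  let t : ℕ → ℝ := fun n => s + 1 / ((n : ℝ) + 1)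
  have hst : ∀ n, s < t n := fun n => lt_add_of_pos_right s Nat.one_div_pos_of_nat
  have htlim : Filter.Tendsto t Filter.atTop (nhds s) := by
    simpa [t] using tendsto_one_div_add_atTop_nhds_zero_nat.const_add s
  let U : ℕ → Submodule ℂ H := fun n => (above k (t n)).kerᗮ
  have hproj : ∀ n, (U n).starProjection = upperProj k (t n) := fun n =>
    Submodule.starProjection_orthogonal' ..
  have hmono : Monotone U := by
    intro m n hmn
    rw [← Submodule.starProjection_le_starProjection_iff, hproj, hproj]
    refine upperProj_antitone k ?_
    have := Nat.one_div_le_one_div (α := ℝ) hmn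
    simp only [t]
    linarith
  let V : Submodule ℂ H := (⨆ n, U n).topologicalClosure
  have hlim : ∀ v, Filter.Tendsto (fun n => upperProj k (t n) v) Filter.atTop
      (nhds (V.starProjection v)) := fun v => by
    simpa only [hproj] using Submodule.starProjection_tendsto_closure_iSup U hmono v
  have hVx : V.starProjection ≤ x := by
    have hx : IsSelfAdjoint x := by
      have h1 := ((ContinuousLinearMap.le_def _ _).1 (h _ (hst 0))).isSelfAdjoint
      simpa using h1.add (isStarProjection_upperProj k (t 0)).isSelfAdjoint
    rw [ContinuousLinearMap.le_def, ContinuousLinearMap.isPositive_def']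
    refine ⟨hx.sub isStarProjection_starProjection.isSelfAdjoint, fun v => ?_⟩
    have h2 : Filter.Tendsto (fun n => (x - upperProj k (t n)).reApplyInnerSelf v) Filter.atTop
        (nhds ((x - V.starProjection).reApplyInnerSelf v)) := by
      simp only [ContinuousLinearMap.reApplyInnerSelf_apply, sub_apply]
      exact (RCLike.continuous_re.tendsto _).comp
        ((tendsto_const_nhds.sub (hlim v)).inner tendsto_const_nhds)
    exact ge_of_tendsto' h2 fun n =>
      ((ContinuousLinearMap.isPositive_def').1 ((ContinuousLinearMap.le_def _ _).1
        (h _ (hst n)))).2 v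
  refine le_trans ?_ hVx
  have h3 : upperProj k s = ((above k s).kerᗮ).starProjection :=
    (Submodule.starProjection_orthogonal' ..).symm
  rw [h3, Submodule.starProjection_le_starProjection_iff]
  simp only [V]
  rw [← Submodule.orthogonal_orthogonal_eq_closure]
  refine Submodule.orthogonal_le fun v hv => ?_
  have hzero : ∀ n, above k (t n) v = 0 := by
    intro n
    have h4 : v ∈ (U n)ᗮ := Submodule.orthogonal_le (le_iSup U n) hv
    simp only [U, Submodule.orthogonal_orthogonal] at h4
    exact h4
  have hnorm : Filter.Tendsto (fun n => above k (t n)) Filter.atTop (nhds (above k s)) := by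
    rw [tendsto_iff_norm_sub_tendsto_zero]
    refine squeeze_zero (fun _ => norm_nonneg _) (fun n => norm_above_sub_le k _ _) ?_
    simpa using (htlim.sub_const s).abs
  have h5 : Filter.Tendsto (fun n => above k (t n) v) Filter.atTop (nhds (above k s v)) :=
    ((ContinuousLinearMap.apply ℂ H v).continuous.tendsto _).comp hnorm
  simp only [hzero] at h5
  exact (tendsto_nhds_unique h5 tendsto_const_nhds)

theorem above_mul_upperProj_neg {k : H →L[ℂ] H} (hk : IsSelfAdjoint k) (s : ℝ) :
    above k s * upperProj (-k) (-s) = 0 := by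
  have h1 := congrArg star (above_mul_above_neg hk s)
  rw [star_mul, (above_nonneg k s).isSelfAdjoint.star_eq,
    (above_nonneg (-k) (-s)).isSelfAdjoint.star_eq, star_zero, ← kerProj_mul_eq_self_iff] at h1
  have h2 := congrArg star h1
  rw [star_mul, (above_nonneg k s).isSelfAdjoint.star_eq,
    (isStarProjection_kerProj (above (-k) (-s))).isSelfAdjoint.star_eq] at h2
  rw [upperProj, mul_sub, mul_one, h2, sub_self]

theorem upperProj_mul_upperProj_neg {k : H →L[ℂ] H} (hk : IsSelfAdjoint k) (s : ℝ) :
    upperProj k s * upperProj (-k) (-s) = 0 := by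
  rw [upperProj, sub_mul, one_mul, kerProj_mul_eq_self_iff.2 (above_mul_upperProj_neg hk s),
    sub_self]

end Operators

/-! ### The trace on a von Neumann algebra -/

section Trace
variable {H : Type*} [NormedAddCommGroup H] [InnerProductSpace ℂ H] [CompleteSpace H]
  {N : VonNeumannAlgebra H}

/-- An operator commuting with everything that commutes with `k` and whose adjoint commutes with `k`
lies in every von Neumann algebra containing `k`. -/
theorem mem_of_forall_commute {k y : H →L[ℂ] H} (hkN : k ∈ N.toStarSubalgebra)
    (h : ∀ x, Commute k x → Commute k (star x) → Commute y x) : y ∈ N.toStarSubalgebra := by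
  have hmem : y ∈ Set.centralizer (Set.centralizer (N : Set (H →L[ℂ] H))) := by
    intro x hx
    refine (h x (hx k hkN) ?_).symm
    have h1 := congrArg star (hx (star k) (star_mem hkN))
    rw [star_mul, star_mul, star_star] at h1
    exact h1.symm
  rw [N.centralizer_centralizer] at hmem
  exact hmem

theorem kerProj_mem {k : H →L[ℂ] H} (hkN : k ∈ N.toStarSubalgebra) :
    kerProj k ∈ N.toStarSubalgebra :=
  mem_of_forall_commute hkN fun _ h h' => (commute_kerProj h.symm h'.symm).symm

theorem above_mem {k : H →L[ℂ] H} (hkN : k ∈ N.toStarSubalgebra) (s : ℝ) :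
    above k s ∈ N.toStarSubalgebra :=
  mem_of_forall_commute hkN fun _ h _ => commute_above h s

theorem upperProj_mem {k : H →L[ℂ] H} (hkN : k ∈ N.toStarSubalgebra) (s : ℝ) :
    upperProj k s ∈ N.toStarSubalgebra :=
  sub_mem (one_mem _) (kerProj_mem (above_mem hkN s))

theorem exists_sq_eq {x : N.toStarSubalgebra} (hx : 0 ≤ x) :
    ∃ s : N.toStarSubalgebra, star s = s ∧ s * s = x := by
  have hx' : (0 : H →L[ℂ] H) ≤ x := hx
  refine ⟨⟨cfc Real.sqrt (x : H →L[ℂ] H), mem_of_forall_commute x.2 fun _ h _ => h.cfc_real _⟩,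
    Subtype.ext ?_, Subtype.ext ?_⟩
  · exact (cfc_predicate Real.sqrt (x : H →L[ℂ] H)).star_eq
  · change cfc Real.sqrt (x : H →L[ℂ] H) * cfc Real.sqrt (x : H →L[ℂ] H) = x
    rw [← cfc_mul ..]
    conv_rhs => rw [← cfc_id' ℝ (x : H →L[ℂ] H)]
    exact cfc_congr fun r hr => Real.mul_self_sqrt (spectrum_nonneg_of_nonneg hx' hr)

variable {τ : N.toStarSubalgebra →ₗ[ℂ] ℂ}

/-- The real part of a functional, as a real-linear functional. For a state nothing is lost on
self-adjoint elements, where its values are real. -/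
noncomputable def reTrace (τ : N.toStarSubalgebra →ₗ[ℂ] ℂ) : N.toStarSubalgebra →ₗ[ℝ] ℝ :=
  Complex.reLm ∘ₗ τ.restrictScalars ℝ

theorem reTrace_apply (x : N.toStarSubalgebra) : reTrace τ x = (τ x).re := rfl

/-- A state is hermitian: apply positivity to `1 + x` and `1 + i x`. -/
theorem IsState.map_star {A : Type*} [Ring A] [StarRing A] [Algebra ℂ A] [StarModule ℂ A]
    {f : A →ₗ[ℂ] ℂ} (hf : IsState f) (x : A) : f (star x) = star (f x) := by
  have him : ∀ a : A, (f (star a * a)).im = 0 := fun a =>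
    ((Complex.le_def.1 (hf.nonneg a)).2).symm
  have h1 := him (1 + x)
  have h2 := him (1 + Complex.I • x)
  have h3 := him x
  have h4 := him 1
  simp only [star_add, star_one, star_smul, add_mul, mul_add, one_mul, mul_one, map_add,
    smul_mul_assoc, mul_smul_comm, map_smul, Complex.add_im] at h1 h2 h3 h4
  simp [h3, h4] at h1 h2
  apply Complex.ext
  · simp; linarith
  · simp; linarith

variable (hτ : IsFaithfulNormalTracialState τ)
include hτ

theorem reTrace_mul_comm (x y : N.toStarSubalgebra) : reTrace τ (x * y) = reTrace τ (y * x) := by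
  rw [reTrace_apply, reTrace_apply, hτ.tracial]

theorem reTrace_star_mul_self_nonneg (x : N.toStarSubalgebra) : 0 ≤ reTrace τ (star x * x) :=
  (Complex.le_def.1 (hτ.isState.nonneg x)).1

theorem eq_zero_of_reTrace_star_mul_self {x : N.toStarSubalgebra}
    (h : reTrace τ (star x * x) = 0) : x = 0 :=
  hτ.faithful x (Complex.ext h (Complex.le_def.1 (hτ.isState.nonneg x)).2.symm)

/-- Traciality turns `τ (s² t²)` into `τ ((s t)* (s t))`. -/
theorem reTrace_mul_nonneg {x y : N.toStarSubalgebra} (hx : 0 ≤ x) (hy : 0 ≤ y) :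
    0 ≤ reTrace τ (x * y) := by
  obtain ⟨s, hs, rfl⟩ := exists_sq_eq hx
  obtain ⟨t, ht, rfl⟩ := exists_sq_eq hy
  have h := reTrace_star_mul_self_nonneg hτ (s * t)
  rw [star_mul, hs, ht, mul_assoc, reTrace_mul_comm hτ] at h
  simpa only [mul_assoc] using h

/-- Faithfulness of the trace, for products of two positive elements. -/
theorem mul_eq_zero_of_reTrace {x y : N.toStarSubalgebra} (hx : 0 ≤ x) (hy : 0 ≤ y)
    (h : reTrace τ (x * y) = 0) : x * y = 0 := by
  obtain ⟨s, hs, rfl⟩ := exists_sq_eq hx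
  obtain ⟨t, ht, rfl⟩ := exists_sq_eq hy
  have h1 : s * t = 0 := eq_zero_of_reTrace_star_mul_self hτ (by
    rw [star_mul, hs, ht, mul_assoc, reTrace_mul_comm hτ]
    simpa only [mul_assoc] using h)
  rw [mul_assoc, ← mul_assoc s t t, h1, zero_mul, mul_zero]

theorem reTrace_nonneg {x : N.toStarSubalgebra} (hx : 0 ≤ x) : 0 ≤ reTrace τ x := by
  obtain ⟨s, hs, rfl⟩ := exists_sq_eq hx
  simpa [hs] using reTrace_star_mul_self_nonneg hτ s

theorem eq_zero_of_reTrace {x : N.toStarSubalgebra} (hx : 0 ≤ x) (h : reTrace τ x = 0) : x = 0 := by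
  obtain ⟨s, hs, rfl⟩ := exists_sq_eq hx
  rw [eq_zero_of_reTrace_star_mul_self hτ (x := s) (by rwa [hs]), zero_mul]

theorem reTrace_pos {x : N.toStarSubalgebra} (hx : 0 ≤ x) (h : x ≠ 0) : 0 < reTrace τ x :=
  (reTrace_nonneg hτ hx).lt_of_ne fun h0 => h (eq_zero_of_reTrace hτ hx h0.symm)

theorem reTrace_mono {x y : N.toStarSubalgebra} (h : x ≤ y) : reTrace τ x ≤ reTrace τ y := by
  have := reTrace_nonneg hτ (sub_nonneg.2 h)
  rwa [map_sub, sub_nonneg] at this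

theorem reTrace_mul_le_of_le_one {x y : N.toStarSubalgebra} (hx : x ≤ 1) (hy : 0 ≤ y) :
    reTrace τ (x * y) ≤ reTrace τ y := by
  have := reTrace_mul_nonneg hτ (sub_nonneg.2 hx) hy
  rwa [sub_mul, one_mul, map_sub, sub_nonneg] at this

theorem reTrace_mul_le_norm_mul (k : N.toStarSubalgebra) (hk : star k = k) {x : N.toStarSubalgebra}
    (hx : 0 ≤ x) : reTrace τ (k * x) ≤ ‖(k : H →L[ℂ] H)‖ * reTrace τ x := by
  have h1 : k ≤ ‖(k : H →L[ℂ] H)‖ • (1 : N.toStarSubalgebra) := by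
    have h2 : IsSelfAdjoint (k : H →L[ℂ] H) := congrArg Subtype.val hk
    have h3 := h2.le_algebraMap_norm_self
    rw [Algebra.algebraMap_eq_smul_one] at h3
    exact h3
  have := reTrace_mul_nonneg hτ (sub_nonneg.2 h1) hx
  rwa [sub_mul, smul_mul_assoc, one_mul, map_sub, map_smul, smul_eq_mul, sub_nonneg] at this

/-- Normality gives right continuity of the trace on the spectral projections. -/
theorem exists_lt_reTrace_upperProj (k : N.toStarSubalgebra) (s : ℝ) {ε : ℝ} (hε : 0 < ε) :
    ∃ t, s < t ∧ reTrace τ ⟨upperProj k s, upperProj_mem k.2 s⟩ - ε <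
      reTrace τ ⟨upperProj k t, upperProj_mem k.2 t⟩ := by
  let P : ℝ → N.toStarSubalgebra := fun t => ⟨upperProj k t, upperProj_mem k.2 t⟩
  have hanti : Antitone P := fun _ _ h => upperProj_antitone (k : H →L[ℂ] H) h
  have hlub : IsLUB (P '' Set.Ioi s) (P s) := by
    constructor
    · rintro _ ⟨t, ht, rfl⟩
      exact hanti (le_of_lt ht)
    · intro x hx
      exact upperProj_le_of_forall_lt fun t ht => hx ⟨t, ht, rfl⟩
  have h := hτ.normal (P '' Set.Ioi s) (P s) ⟨_, s + 1, lt_add_one s, rfl⟩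
    (by
      rintro _ ⟨t, -, rfl⟩
      exact Subtype.ext (isStarProjection_upperProj (k : H →L[ℂ] H) t).isSelfAdjoint.star_eq)
    (by
      rintro _ ⟨t, ht, rfl⟩ _ ⟨u, hu, rfl⟩
      exact ⟨P (min t u), ⟨min t u, Set.mem_Ioi.2 (lt_min ht hu), rfl⟩, hanti (min_le_left _ _),
        hanti (min_le_right _ _)⟩) hlub
  obtain ⟨_, ⟨_, ⟨t, ht, rfl⟩, rfl⟩, hlt, -⟩ :=
    h.exists_between (sub_lt_self (reTrace τ (P s)) hε)
  exact ⟨t, ht, hlt⟩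

end Trace

/-! ### Elements of maximal trace with vanishing integral -/

section Maximizer
variable {H : Type*} [NormedAddCommGroup H] [InnerProductSpace ℂ H] [CompleteSpace H]
  {N : VonNeumannAlgebra H} {τ : N.toStarSubalgebra →ₗ[ℂ] ℂ}

theorem mul_nonneg_of_commute {x y : N.toStarSubalgebra} (hx : 0 ≤ x) (hy : 0 ≤ y)
    (h : Commute x y) : 0 ≤ x * y :=
  Commute.mul_nonneg (A := H →L[ℂ] H) hx hy (congrArg Subtype.val h.eq)

theorem smul_nonneg_of_nonneg {r : ℝ} {x : N.toStarSubalgebra} (hr : 0 ≤ r) (hx : 0 ≤ x) :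
    0 ≤ r • x := by
  have hx' : (0 : H →L[ℂ] H) ≤ x := hx
  exact (smul_nonneg hr hx' : (0 : H →L[ℂ] H) ≤ r • (x : H →L[ℂ] H))

/-- The Neyman–Pearson threshold for `k`: a level `s > 0` such that `τ (e k) ≤ 0` for the spectral
projection `e` of `k` for `(-∞, s)`, and `τ (e k) ≥ 0` for that for `(-∞, s]`. It is the infimum of
the levels of the second kind; both inequalities pass to the limit by normality of the trace. -/
theorem exists_threshold (hτ : IsFaithfulNormalTracialState τ) (k : N.toStarSubalgebra)
    (hk : star k = k) (hpos : 0 ≤ reTrace τ k) (hnot : ¬ 0 ≤ k) :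
    ∃ s : ℝ, 0 < s ∧
      0 ≤ reTrace τ ((1 - ⟨upperProj k s, upperProj_mem k.2 s⟩) * k) ∧
      reTrace τ
        (⟨upperProj (-(k : H →L[ℂ] H)) (-s), upperProj_mem (neg_mem k.2) (-s)⟩ * k) ≤ 0 := by
  have hk' : IsSelfAdjoint (k : H →L[ℂ] H) := congrArg Subtype.val hk
  have hnk : ‖((-k : N.toStarSubalgebra) : H →L[ℂ] H)‖ = ‖(k : H →L[ℂ] H)‖ := norm_neg _
  let P : ℝ → N.toStarSubalgebra := fun t => ⟨upperProj k t, upperProj_mem k.2 t⟩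
  let Q : ℝ → N.toStarSubalgebra := fun t =>
    ⟨upperProj (-(k : H →L[ℂ] H)) (-t), upperProj_mem (neg_mem k.2) (-t)⟩
  let R : ℝ → N.toStarSubalgebra := fun t => ⟨above k t, above_mem k.2 t⟩
  let R' : ℝ → N.toStarSubalgebra := fun t =>
    ⟨above (-(k : H →L[ℂ] H)) (-t), above_mem (neg_mem k.2) (-t)⟩
  have hP : Antitone P := fun _ _ h => upperProj_antitone (k : H →L[ℂ] H) h
  have hQ : Monotone Q := fun _ _ h => upperProj_antitone (-(k : H →L[ℂ] H)) (neg_le_neg h)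
  have hP1 : ∀ t, 0 ≤ 1 - P t := fun t =>
    (isStarProjection_upperProj (k : H →L[ℂ] H) t).one_sub.nonneg
  have hQ1 : ∀ t, 0 ≤ 1 - Q t := fun t =>
    (isStarProjection_upperProj (-(k : H →L[ℂ] H)) (-t)).one_sub.nonneg
  have hR : ∀ t, R t - R' t = k - t • 1 := fun t => Subtype.ext (above_sub_above_neg hk' t)
  have hR' : ∀ t, 0 ≤ R' t := fun t => above_nonneg (-(k : H →L[ℂ] H)) (-t)
  have hRP : ∀ t, R t * P t = R t := fun t => Subtype.ext (above_mul_upperProj (k : H →L[ℂ] H) t)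
  have hRQ : ∀ t, R t * Q t = 0 := fun t => Subtype.ext (above_mul_upperProj_neg hk' t)
  have hRQ' : ∀ t, R' t * Q t = R' t := fun t =>
    Subtype.ext (above_mul_upperProj (-(k : H →L[ℂ] H)) (-t))
  have hRP' : ∀ t, R' t * P t = 0 := fun t => Subtype.ext (by
    have := above_mul_upperProj_neg hk'.neg (-t)
    rwa [neg_neg, neg_neg] at this)
  have hPQ : ∀ t, P t * Q t = 0 := fun t => Subtype.ext (upperProj_mul_upperProj_neg hk' t)
  -- the levels at or below which the integral is nonnegative; the threshold is their infimum
  let S : Set ℝ := {t | 0 ≤ t ∧ 0 ≤ reTrace τ ((1 - P t) * k)}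
  have hSne : S.Nonempty := by
    refine ⟨‖(k : H →L[ℂ] H)‖, norm_nonneg _, ?_⟩
    have : P ‖(k : H →L[ℂ] H)‖ = 0 := Subtype.ext (upperProj_norm _)
    rwa [this, sub_zero, one_mul]
  have hSbdd : BddBelow S := ⟨0, fun t ht => ht.1⟩
  have hs0 : 0 ≤ sInf S := le_csInf hSne fun t ht => ht.1
  have hi : 0 ≤ reTrace τ ((1 - P (sInf S)) * k) := by
    refine le_of_forall_pos_le_add fun ε hε => ?_
    obtain ⟨t₀, ht₀, hlt⟩ := exists_lt_reTrace_upperProj hτ k (sInf S)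
      (ε := ε / (‖(k : H →L[ℂ] H)‖ + 1)) (by positivity)
    obtain ⟨t, htS, htt⟩ := exists_lt_of_csInf_lt hSne ht₀
    have h1 := reTrace_mul_le_norm_mul hτ k hk (sub_nonneg.2 (hP (csInf_le hSbdd htS)))
    have h2 := reTrace_mono hτ (hP htt.le)
    have h3 : reTrace τ ((1 - P (sInf S)) * k) =
        reTrace τ ((1 - P t) * k) - reTrace τ (k * (P (sInf S) - P t)) := by
      rw [reTrace_mul_comm hτ k, ← map_sub]
      congr 1
      noncomm_ring
    have h4 := htS.2
    rw [map_sub] at h1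
    have h5 : reTrace τ (P (sInf S)) - reTrace τ (P t) ≤ ε / (‖(k : H →L[ℂ] H)‖ + 1) := by
      change reTrace τ (P (sInf S)) - _ < reTrace τ (P t₀) at hlt
      linarith
    have h6 := mul_le_mul_of_nonneg_left h5 (norm_nonneg (k : H →L[ℂ] H))
    have h7 : ‖(k : H →L[ℂ] H)‖ * (ε / (‖(k : H →L[ℂ] H)‖ + 1)) ≤ ε := by
      rw [mul_div_assoc', div_le_iff₀ (by positivity)]
      nlinarith
    linarith
  -- at level `0` the integral is `-τ(k₋)`, which is negative
  have hspos : 0 < sInf S := by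
    refine hs0.lt_of_ne fun h0 => hnot ?_
    rw [← h0] at hi
    have h1 : (1 - P 0) * k = -R' 0 := by
      have h2 : k = R 0 - R' 0 := by rw [hR, zero_smul, sub_zero]
      have h3 : P 0 * k = k * P 0 :=
        Subtype.ext (commute_upperProj (Commute.refl _) (by rw [hk'.star_eq]) 0).eq
      rw [sub_mul, one_mul, h3, h2, sub_mul, hRP, hRP']
      abel
    rw [h1, map_neg] at hi
    have h4 := eq_zero_of_reTrace hτ (hR' 0) (le_antisymm (by linarith) (reTrace_nonneg hτ (hR' 0)))
    have h5 := hR 0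
    rw [h4, zero_smul, sub_zero, sub_zero] at h5
    rw [← h5]
    exact above_nonneg (k : H →L[ℂ] H) 0
  refine ⟨sInf S, hspos, hi, ?_⟩
  change reTrace τ (Q (sInf S) * k) ≤ 0
  refine le_of_forall_pos_le_add fun ε hε => ?_
  obtain ⟨t', ht', hlt⟩ := exists_lt_reTrace_upperProj hτ (-k) (-sInf S)
    (ε := ε / (‖(k : H →L[ℂ] H)‖ + 1)) (by positivity)
  -- the level `-t'` may be negative, and only nonnegative levels are compared with `S`
  obtain ⟨t, ht0, hts, htt'⟩ : ∃ t : ℝ, 0 ≤ t ∧ t < sInf S ∧ -t ≤ t' :=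
    ⟨max (-t') 0, le_max_right _ _, max_lt (by linarith) hspos, neg_le.1 (le_max_left _ _)⟩
  have h1 : reTrace τ ((1 - P t) * k) < 0 := by
    by_contra! hcon
    exact absurd (csInf_le hSbdd (show t ∈ S from ⟨ht0, hcon⟩)) (not_le.2 hts)
  -- on the eigenspace of level `t`, which is the difference, `k` is the nonnegative constant `t`
  have h2 : reTrace τ (Q t * k) ≤ reTrace τ ((1 - P t) * k) := by
    have h3 : k * (1 - P t - Q t) = t • (1 - P t - Q t) := by
      have h4 : k = R t - R' t + t • 1 := by rw [hR]; abel
      conv_lhs => rw [h4]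
      rw [add_mul, smul_mul_assoc, one_mul, sub_mul, mul_sub, mul_sub, mul_sub, mul_sub, hRP, hRQ,
        hRP', hRQ', mul_one, mul_one]
      abel
    have h5 : 0 ≤ reTrace τ (1 - P t - Q t) := by
      have h6 := reTrace_mul_nonneg hτ (hP1 t) (hQ1 t)
      rwa [sub_mul, one_mul, mul_sub, mul_one, hPQ, sub_zero, sub_right_comm] at h6
    have h7 : reTrace τ ((1 - P t) * k) - reTrace τ (Q t * k) = t * reTrace τ (1 - P t - Q t) := by
      rw [← map_sub, ← sub_mul, reTrace_mul_comm hτ, h3, map_smul, smul_eq_mul]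
    have h8 := mul_nonneg ht0 h5
    linarith
  have h3 := reTrace_mul_le_norm_mul hτ k hk (sub_nonneg.2 (hQ hts.le))
  have h4 : reTrace τ (Q (sInf S) * k) =
      reTrace τ (Q t * k) + reTrace τ (k * (Q (sInf S) - Q t)) := by
    rw [reTrace_mul_comm hτ k, ← map_add]
    congr 1
    noncomm_ring
  have h5 : reTrace τ (Q (sInf S)) - reTrace τ (Q t) ≤ ε / (‖(k : H →L[ℂ] H)‖ + 1) := by
    have h6 : (⟨upperProj (-(k : H →L[ℂ] H)) t', upperProj_mem (neg_mem k.2) t'⟩ :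
        N.toStarSubalgebra) ≤ Q t := upperProj_antitone (-(k : H →L[ℂ] H)) htt'
    have h7 := reTrace_mono hτ h6
    change reTrace τ (Q (sInf S)) - _ < reTrace τ ⟨upperProj (-(k : H →L[ℂ] H)) t', _⟩ at hlt
    linarith
  have h6 := mul_le_mul_of_nonneg_left h5 (norm_nonneg (k : H →L[ℂ] H))
  have h7 : ‖(k : H →L[ℂ] H)‖ * (ε / (‖(k : H →L[ℂ] H)‖ + 1)) ≤ ε := by
    rw [mul_div_assoc', div_le_iff₀ (by positivity)]
    nlinarith
  rw [map_sub] at h3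
  linarith

/-- `a` maximizes the trace among the elements `0 ≤ a ≤ 1` of the corner of `p` on which
`a ↦ τ (a * k)` vanishes, and its trace is positive. The corner condition `a ≤ p` is encoded as
`a * p = a`, which is the same for `0 ≤ a ≤ 1`. -/
structure IsMaximizer (τ : N.toStarSubalgebra →ₗ[ℂ] ℂ) (p k a : N.toStarSubalgebra) : Prop where
  nonneg : 0 ≤ a
  le_one : a ≤ 1
  mul_corner : a * p = a
  integral_eq : reTrace τ (a * k) = 0
  pos : 0 < reTrace τ a
  max : ∀ b : N.toStarSubalgebra, 0 ≤ b → b ≤ 1 → b * p = b → reTrace τ (b * k) = 0 →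
    reTrace τ b ≤ reTrace τ a

theorem IsMaximizer.neg {p k a : N.toStarSubalgebra} (h : IsMaximizer τ p (-k) a) :
    IsMaximizer τ p k a where
  nonneg := h.nonneg
  le_one := h.le_one
  mul_corner := h.mul_corner
  integral_eq := by simpa using h.integral_eq
  pos := h.pos
  max b hb hb1 hbp hbk := h.max b hb hb1 hbp (by simpa using hbk)

/-- For `k ≥ 0` the condition `τ (a * k) = 0` forces `a` to live on the kernel of `k`, so the
projection onto the kernel inside the corner is the maximizer. -/
theorem exists_isMaximizer_of_nonneg (hτ : IsFaithfulNormalTracialState τ)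
    {p k : N.toStarSubalgebra} (hp : IsStarProjection (p : H →L[ℂ] H)) (hk : 0 ≤ k)
    (hkp : k * p = k) {v : H} (hv : v ≠ 0) (hpv : (p : H →L[ℂ] H) v = v)
    (hkv : (inner ℂ v ((k : H →L[ℂ] H) v)).re = 0) : ∃ a, IsMaximizer τ p k a := by
  have hk' : (0 : H →L[ℂ] H) ≤ k := hk
  have hks : star k = k := Subtype.ext hk'.isSelfAdjoint.star_eq
  have hps : star p = p := Subtype.ext hp.isSelfAdjoint.star_eq
  have hpp : p * p = p := Subtype.ext hp.isIdempotentElem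
  have hpk : p * k = k := by
    have := congrArg star hkp
    rwa [star_mul, hps, hks] at this
  let e : N.toStarSubalgebra := ⟨kerProj k, kerProj_mem k.2⟩
  have heproj := isStarProjection_kerProj (k : H →L[ℂ] H)
  have hes : star e = e := Subtype.ext heproj.isSelfAdjoint.star_eq
  have hke : k * e = 0 := Subtype.ext (mul_kerProj (k : H →L[ℂ] H))
  have hek : e * k = 0 := by
    have := congrArg star hke
    rwa [star_mul, hes, hks, star_zero] at this
  have hpe : p * e = e * p := by
    have h1 : Commute (p : H →L[ℂ] H) (k : H →L[ℂ] H) := congrArg Subtype.val (hpk.trans hkp.symm)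
    exact Subtype.ext (commute_kerProj h1 (by rwa [hp.isSelfAdjoint.star_eq])).eq
  have hp0 : 0 ≤ p := hp.nonneg
  have hp1 : 0 ≤ 1 - p := hp.one_sub.nonneg
  have he0 : 0 ≤ e := heproj.nonneg
  have he1 : 0 ≤ 1 - e := heproj.one_sub.nonneg
  have hq0 : 0 ≤ p * e := mul_nonneg_of_commute hp0 he0 hpe
  refine ⟨p * e, hq0, ?_, by rw [mul_assoc, ← hpe, ← mul_assoc, hpp], by rw [mul_assoc, hek]; simp,
    reTrace_pos hτ hq0 fun h0 => hv ?_, fun b hb hb1 hbp hbk => ?_⟩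
  · have h1 := mul_nonneg_of_commute hp0 he1 ((Commute.one_right p).sub_right hpe)
    rw [mul_sub, mul_one] at h1
    exact (sub_nonneg.1 h1).trans (sub_nonneg.1 hp1)
  · have h1 : kerProj (k : H →L[ℂ] H) v = v :=
      kerProj_apply_eq_self_iff.2 (apply_eq_zero_of_nonneg hk' hkv)
    have h2 : (p : H →L[ℂ] H) (kerProj (k : H →L[ℂ] H) v) = 0 :=
      congrArg (fun x : N.toStarSubalgebra => (x : H →L[ℂ] H) v) h0
    rwa [h1, hpv] at h2
  · have hb' : (0 : H →L[ℂ] H) ≤ b := hb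
    have hbs : star b = b := Subtype.ext hb'.isSelfAdjoint.star_eq
    have h1 : k * b = 0 := mul_eq_zero_of_reTrace hτ hk hb (by rwa [reTrace_mul_comm hτ])
    have h2 : e * b = b := Subtype.ext (kerProj_mul_eq_self_iff.2 (congrArg Subtype.val h1))
    have h3 : b * (p * e) = b := by
      have := congrArg star h2
      rw [star_mul, hes, hbs] at this
      rw [← mul_assoc, hbp, this]
    have h4 := reTrace_mul_le_of_le_one hτ hb1 hq0
    rwa [h3] at h4

/-- The Neyman–Pearson argument. With `s` the threshold, the element `z` that is `1` below `s`, `0`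
above it and a suitable constant at `s` satisfies `(s - k) z = (s - k)₊`, and `p * z` is optimal
since `s τ(b) = τ(b (s - k)) ≤ τ(p (s - k)₊)` for every competitor `b`. -/
theorem exists_isMaximizer_of_not_nonneg (hτ : IsFaithfulNormalTracialState τ)
    {p k : N.toStarSubalgebra} (hp : IsStarProjection (p : H →L[ℂ] H)) (hks : star k = k)
    (hkp : k * p = k) (hpos : 0 ≤ reTrace τ k) (hnot : ¬ 0 ≤ k) {v : H} (hv : v ≠ 0)
    (hpv : (p : H →L[ℂ] H) v = v)
    (hkv : (inner ℂ v ((k : H →L[ℂ] H) v)).re = 0) : ∃ a, IsMaximizer τ p k a := by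
  have hk' : IsSelfAdjoint (k : H →L[ℂ] H) := congrArg Subtype.val hks
  obtain ⟨s, hs, hi, hii⟩ := exists_threshold hτ k hks hpos hnot
  have hps : star p = p := Subtype.ext hp.isSelfAdjoint.star_eq
  have hpp : p * p = p := Subtype.ext hp.isIdempotentElem
  have hpk : p * k = k := by
    have := congrArg star hkp
    rwa [star_mul, hps, hks] at this
  have hkp' : Commute (k : H →L[ℂ] H) (p : H →L[ℂ] H) := congrArg Subtype.val (hkp.trans hpk.symm)
  have hkps : Commute (k : H →L[ℂ] H) (star (p : H →L[ℂ] H)) := by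
    rwa [hp.isSelfAdjoint.star_eq]
  let P : N.toStarSubalgebra := ⟨upperProj k s, upperProj_mem k.2 s⟩
  let Q : N.toStarSubalgebra :=
    ⟨upperProj (-(k : H →L[ℂ] H)) (-s), upperProj_mem (neg_mem k.2) (-s)⟩
  let R : N.toStarSubalgebra := ⟨above k s, above_mem k.2 s⟩
  let R' : N.toStarSubalgebra := ⟨above (-(k : H →L[ℂ] H)) (-s), above_mem (neg_mem k.2) (-s)⟩
  have hP1 : 0 ≤ 1 - P := (isStarProjection_upperProj (k : H →L[ℂ] H) s).one_sub.nonneg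
  have hP0 : 0 ≤ P := (isStarProjection_upperProj (k : H →L[ℂ] H) s).nonneg
  have hQ0 : 0 ≤ Q := (isStarProjection_upperProj (-(k : H →L[ℂ] H)) (-s)).nonneg
  have hQ1 : 0 ≤ 1 - Q := (isStarProjection_upperProj (-(k : H →L[ℂ] H)) (-s)).one_sub.nonneg
  have hR : R - R' = k - s • 1 := Subtype.ext (above_sub_above_neg hk' s)
  have hR0 : 0 ≤ R := above_nonneg (k : H →L[ℂ] H) s
  have hR'0 : 0 ≤ R' := above_nonneg (-(k : H →L[ℂ] H)) (-s)
  have hRP : R * P = R := Subtype.ext (above_mul_upperProj (k : H →L[ℂ] H) s)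
  have hRQ : R * Q = 0 := Subtype.ext (above_mul_upperProj_neg hk' s)
  have hRQ' : R' * Q = R' := Subtype.ext (above_mul_upperProj (-(k : H →L[ℂ] H)) (-s))
  have hRP' : R' * P = 0 := Subtype.ext (by
    have := above_mul_upperProj_neg hk'.neg (-s)
    rwa [neg_neg, neg_neg] at this)
  have hpP : Commute p P := Subtype.ext (commute_upperProj hkp' hkps s).eq.symm
  have hpQ : Commute p Q :=
    Subtype.ext (commute_upperProj hkp'.neg_left hkps.neg_left (-s)).eq.symm
  have hpR' : Commute p R' := Subtype.ext (commute_above hkp'.neg_left (-s)).eq.symm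
  have hp0 : 0 ≤ p := hp.nonneg
  have hp1 : 0 ≤ 1 - p := hp.one_sub.nonneg
  -- the mass on the threshold itself is split so that the integral vanishes
  obtain ⟨r, hr0, hr1, hr⟩ : ∃ r : ℝ, 0 ≤ r ∧ r ≤ 1 ∧
      r * reTrace τ ((1 - P) * k) + (1 - r) * reTrace τ (Q * k) = 0 := by
    change 0 ≤ reTrace τ ((1 - P) * k) at hi
    change reTrace τ (Q * k) ≤ 0 at hii
    generalize reTrace τ ((1 - P) * k) = x at hi ⊢
    generalize reTrace τ (Q * k) = y at hii ⊢
    rcases eq_or_lt_of_le (sub_nonneg.2 (hii.trans hi)) with h | h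
    · exact ⟨0, le_rfl, zero_le_one, by linarith⟩
    · refine ⟨-y / (x - y), div_nonneg (by linarith) h.le, (div_le_one h).2 (by linarith), ?_⟩
      field_simp
      ring
  let z : N.toStarSubalgebra := r • (1 - P) + (1 - r) • Q
  have hz0 : 0 ≤ z :=
    add_nonneg (smul_nonneg_of_nonneg hr0 hP1) (smul_nonneg_of_nonneg (sub_nonneg.2 hr1) hQ0)
  have hz1 : 0 ≤ 1 - z := by
    have h1 : 1 - z = r • P + (1 - r) • (1 - Q) := by
      simp only [z]
      module
    rw [h1]
    exact add_nonneg (smul_nonneg_of_nonneg hr0 hP0) (smul_nonneg_of_nonneg (sub_nonneg.2 hr1) hQ1)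
  have hpz : Commute p z :=
    (((Commute.one_right p).sub_right hpP).smul_right r).add_right (hpQ.smul_right (1 - r))
  have ha0 : 0 ≤ p * z := mul_nonneg_of_commute hp0 hz0 hpz
  have hsk : (s • 1 - k) * z = R' := by
    have h1 : s • 1 - k = R' - R := by rw [← neg_sub k, ← hR, neg_sub]
    have h2 : R * (1 - P) = 0 := by rw [mul_sub, mul_one, hRP, sub_self]
    have h3 : R' * (1 - P) = R' := by rw [mul_sub, mul_one, hRP', sub_zero]
    rw [h1, sub_mul, mul_add, mul_add, mul_smul_comm, mul_smul_comm, mul_smul_comm, mul_smul_comm,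
      h2, h3, hRQ, hRQ']
    module
  have hint : reTrace τ (p * z * k) = 0 := by
    rw [reTrace_mul_comm hτ, ← mul_assoc, hkp, reTrace_mul_comm hτ, add_mul, map_add,
      smul_mul_assoc, smul_mul_assoc, map_smul, map_smul]
    exact hr
  have hval : s * reTrace τ (p * z) = reTrace τ (p * R') := by
    rw [← hsk, sub_mul, smul_mul_assoc, one_mul, mul_sub, mul_smul_comm, map_sub, map_smul,
      ← mul_assoc p k z, hpk, ← hkp, mul_assoc, reTrace_mul_comm hτ k, hint, sub_zero, smul_eq_mul]
  have hpR'0 : 0 ≤ p * R' := mul_nonneg_of_commute hp0 hR'0 hpR'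
  refine ⟨p * z, ha0, ?_, by rw [hpz.eq, mul_assoc, hpp], hint, ?_, fun b hb hb1 hbp hbk => ?_⟩
  · have h1 := mul_nonneg_of_commute hp0 hz1 ((Commute.one_right p).sub_right hpz)
    rw [mul_sub, mul_one] at h1
    exact (sub_nonneg.1 h1).trans (sub_nonneg.1 hp1)
  · refine (reTrace_nonneg hτ ha0).lt_of_ne fun h0 => ?_
    rw [← h0, mul_zero] at hval
    have h1 := eq_zero_of_reTrace hτ hpR'0 hval.symm
    rw [hpR'.eq] at h1
    have h2 : (R' : H →L[ℂ] H) ((p : H →L[ℂ] H) v) = 0 :=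
      congrArg (fun x : N.toStarSubalgebra => (x : H →L[ℂ] H) v) h1
    rw [hpv] at h2
    have h3 : (R : H →L[ℂ] H) v - (R' : H →L[ℂ] H) v = (k : H →L[ℂ] H) v - s • v :=
      congrArg (fun x : N.toStarSubalgebra => (x : H →L[ℂ] H) v) hR
    have h4 := ((ContinuousLinearMap.nonneg_iff_isPositive _).1 hR0).re_inner_nonneg_right v
    rw [h2, sub_zero] at h3
    rw [h3, inner_sub_right, map_sub, ← Complex.coe_smul, inner_smul_right] at h4
    change 0 ≤ (inner ℂ v ((k : H →L[ℂ] H) v)).re - ((s : ℂ) * inner ℂ v v).re at h4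
    rw [hkv, Complex.re_ofReal_mul] at h4
    have h5 : 0 < (inner ℂ v v : ℂ).re := by
      have := inner_self_eq_norm_sq (𝕜 := ℂ) v
      change (inner ℂ v v : ℂ).re = _ at this
      rw [this]
      have := norm_pos_iff.2 hv
      positivity
    have := mul_pos hs h5
    linarith
  · refine le_of_mul_le_mul_left ?_ hs
    rw [hval]
    have h1 : s * reTrace τ b = reTrace τ (b * R') - reTrace τ (b * R) := by
      have h2 : s • b = b * R' - b * R + b * k := by
        rw [← mul_sub, ← neg_sub R R', hR, mul_neg, mul_sub, mul_smul_comm, mul_one]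
        abel
      rw [← smul_eq_mul, ← map_smul, h2, map_add, map_sub, hbk, add_zero]
    have h3 := reTrace_mul_nonneg hτ hb hR0
    have h4 := reTrace_mul_le_of_le_one hτ hb1 hpR'0
    rw [← mul_assoc, hbp] at h4
    linarith

/-- The vector `v` says that zero is a value of the quadratic form of `k` on the range of `p`. This
condition and the notion of a maximizer are symmetric under `k ↦ -k`, which reduces to
`0 ≤ τ k`. -/
theorem exists_isMaximizer (hτ : IsFaithfulNormalTracialState τ)
    {p k : N.toStarSubalgebra} (hp : IsStarProjection (p : H →L[ℂ] H)) (hks : star k = k)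
    (hkp : k * p = k) {v : H} (hv : v ≠ 0) (hpv : (p : H →L[ℂ] H) v = v)
    (hkv : (inner ℂ v ((k : H →L[ℂ] H) v)).re = 0) : ∃ a, IsMaximizer τ p k a := by
  have hks' : star (-k) = -k := by rw [star_neg, hks]
  have hkp' : -k * p = -k := by rw [neg_mul, hkp]
  have hkv' : (inner ℂ v (((-k : N.toStarSubalgebra) : H →L[ℂ] H) v)).re = 0 := by
    change (inner ℂ v (-((k : H →L[ℂ] H) v))).re = 0
    rw [inner_neg_right, Complex.neg_re, hkv, neg_zero]
  by_cases h1 : 0 ≤ k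
  · exact exists_isMaximizer_of_nonneg hτ hp h1 hkp hv hpv hkv
  by_cases h2 : 0 ≤ -k
  · obtain ⟨a, ha⟩ := exists_isMaximizer_of_nonneg hτ hp h2 hkp' hv hpv hkv'
    exact ⟨a, ha.neg⟩
  rcases le_total 0 (reTrace τ k) with h | h
  · exact exists_isMaximizer_of_not_nonneg hτ hp hks hkp h h1 hv hpv hkv
  · obtain ⟨a, ha⟩ := exists_isMaximizer_of_not_nonneg hτ hp hks' hkp' (by simpa using h) h2 hv hpv
      hkv'
    exact ⟨a, ha.neg⟩

end Maximizer

/-! ### Zeros of quadratic forms -/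

section Compression
variable {H : Type*} [NormedAddCommGroup H] [InnerProductSpace ℂ H] [CompleteSpace H]
  {N : VonNeumannAlgebra H} {τ : N.toStarSubalgebra →ₗ[ℂ] ℂ}

omit [CompleteSpace H] in
/-- The intermediate value theorem along the segment from `x` to `y`, which avoids the origin
because the quadratic form has opposite signs at its end points. -/
theorem exists_inner_eq_zero (p k : H →L[ℂ] H) {x y : H} (hpx : p x = x) (hpy : p y = y)
    (hkx : (inner ℂ x (k x)).re < 0) (hky : 0 < (inner ℂ y (k y)).re) :
    ∃ z, z ≠ 0 ∧ p z = z ∧ (inner ℂ z (k z)).re = 0 := by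
  let γ : ℝ → H := fun t => ((1 - t : ℝ) : ℂ) • x + (t : ℂ) • y
  have hγ : Continuous γ := by fun_prop
  have hcont : Continuous fun t => (inner ℂ (γ t) (k (γ t))).re := by fun_prop
  have h0 : (inner ℂ (γ 0) (k (γ 0))).re < 0 := by simpa [γ] using hkx
  have h1 : 0 < (inner ℂ (γ 1) (k (γ 1))).re := by simpa [γ] using hky
  obtain ⟨t, ht, hzero⟩ := intermediate_value_Icc zero_le_one hcont.continuousOn ⟨h0.le, h1.le⟩
  refine ⟨γ t, fun hcon => ?_, by simp [γ, hpx, hpy], hzero⟩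
  have h2 : (t : ℂ) • y = ((t - 1 : ℝ) : ℂ) • x := by
    rw [← sub_eq_zero, ← hcon]
    simp only [γ]
    push_cast
    module
  have h3 : t ^ 2 * (inner ℂ y (k y)).re = (t - 1) ^ 2 * (inner ℂ x (k x)).re := by
    have h4 := congrArg (fun v => (inner ℂ v (k v)).re) h2
    simp only [map_smul, inner_smul_left, inner_smul_right, Complex.conj_ofReal,
      Complex.re_ofReal_mul] at h4
    linarith
  have h4 : 0 ≤ t ^ 2 * (inner ℂ y (k y)).re := by positivity
  have h5 : (t - 1) ^ 2 * (inner ℂ x (k x)).re ≤ 0 :=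
    mul_nonpos_of_nonneg_of_nonpos (sq_nonneg _) hkx.le
  have h6 : t ^ 2 = 0 := by
    refine (mul_eq_zero.1 (le_antisymm ?_ h4)).resolve_right hky.ne'
    linarith
  have h7 : (t - 1) ^ 2 = 0 := by
    refine (mul_eq_zero.1 (le_antisymm h5 ?_)).resolve_right hkx.ne
    linarith
  nlinarith

/-- If `a ≥ 0` lives in the corner of `p`, is nonzero, and `τ (a * k) = 0`, then the quadratic form
of `k` has a zero on the range of `p`. Otherwise it is definite there, and faithfulness of the trace
forces `k * a = 0`. -/
theorem exists_inner_eq_zero_of_reTrace (hτ : IsFaithfulNormalTracialState τ)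
    {p k a : N.toStarSubalgebra} (hps : star p = p) (hpp : p * p = p) (hks : star k = k)
    (hkp : k * p = k) (ha : 0 ≤ a) (ha0 : a ≠ 0) (hap : a * p = a) (hak : reTrace τ (a * k) = 0) :
    ∃ v : H, v ≠ 0 ∧ (p : H →L[ℂ] H) v = v ∧ (inner ℂ v ((k : H →L[ℂ] H) v)).re = 0 := by
  by_contra! hcon
  have ha' : (0 : H →L[ℂ] H) ≤ a := ha
  have hpa : p * a = a := by
    have := congrArg star hap
    rwa [star_mul, hps, show star a = a from Subtype.ext ha'.isSelfAdjoint.star_eq] at this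
  have hpv : ∀ v, (p : H →L[ℂ] H) ((p : H →L[ℂ] H) v) = (p : H →L[ℂ] H) v := fun v =>
    congrArg (fun x : N.toStarSubalgebra => (x : H →L[ℂ] H) v) hpp
  have hpk : p * k = k := by
    have := congrArg star hkp
    rwa [star_mul, hps, hks] at this
  have hform : ∀ v, inner ℂ v ((k : H →L[ℂ] H) v) =
      inner ℂ ((p : H →L[ℂ] H) v) ((k : H →L[ℂ] H) ((p : H →L[ℂ] H) v)) := by
    intro v
    have h1 : (k : H →L[ℂ] H) ((p : H →L[ℂ] H) v) = (k : H →L[ℂ] H) v :=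
      congrArg (fun x : N.toStarSubalgebra => (x : H →L[ℂ] H) v) hkp
    have h2 : (p : H →L[ℂ] H) ((k : H →L[ℂ] H) v) = (k : H →L[ℂ] H) v :=
      congrArg (fun x : N.toStarSubalgebra => (x : H →L[ℂ] H) v) hpk
    have h3 : star (p : H →L[ℂ] H) = p := congrArg Subtype.val hps
    rw [h1, ← ContinuousLinearMap.adjoint_inner_right, ← ContinuousLinearMap.star_eq_adjoint, h3,
      h2]
  obtain ⟨w, hw⟩ : ∃ w, (a : H →L[ℂ] H) w ≠ 0 := by
    by_contra! h
    exact ha0 (Subtype.ext (ContinuousLinearMap.ext h))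
  have hpw : (p : H →L[ℂ] H) ((a : H →L[ℂ] H) w) = (a : H →L[ℂ] H) w :=
    congrArg (fun x : N.toStarSubalgebra => (x : H →L[ℂ] H) w) hpa
  -- it suffices that `k` annihilates the vector `a w` in the range of `p`
  suffices h : k * a = 0 by
    have h1 : (k : H →L[ℂ] H) ((a : H →L[ℂ] H) w) = 0 :=
      congrArg (fun x : N.toStarSubalgebra => (x : H →L[ℂ] H) w) h
    exact hcon _ hw hpw (by rw [h1, inner_zero_right, Complex.zero_re])
  have hk' : IsSelfAdjoint (k : H →L[ℂ] H) := congrArg Subtype.val hks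
  rcases lt_or_gt_of_ne (hcon _ hw hpw) with hneg | hpos
  · have hk0 : 0 ≤ -k := by
      change (0 : H →L[ℂ] H) ≤ -(k : H →L[ℂ] H)
      rw [ContinuousLinearMap.nonneg_iff_isPositive, ContinuousLinearMap.isPositive_def']
      refine ⟨hk'.neg, fun v => ?_⟩
      rw [ContinuousLinearMap.reApplyInnerSelf_apply, inner_re_symm]
      change 0 ≤ (inner ℂ v (-((k : H →L[ℂ] H) v))).re
      rw [inner_neg_right, Complex.neg_re, hform, Left.nonneg_neg_iff]
      by_contra! h
      obtain ⟨z, hz, hpz, hkz⟩ := exists_inner_eq_zero (p : H →L[ℂ] H) k hpw (hpv v) hneg h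
      exact hcon z hz hpz hkz
    have h1 : -k * a = 0 := mul_eq_zero_of_reTrace hτ hk0 ha (by
      rw [reTrace_mul_comm hτ, mul_neg, map_neg, hak, neg_zero])
    rwa [neg_mul, neg_eq_zero] at h1
  · have hk0 : 0 ≤ k := by
      change (0 : H →L[ℂ] H) ≤ (k : H →L[ℂ] H)
      rw [ContinuousLinearMap.nonneg_iff_isPositive, ContinuousLinearMap.isPositive_def']
      refine ⟨hk', fun v => ?_⟩
      rw [ContinuousLinearMap.reApplyInnerSelf_apply, inner_re_symm]
      change 0 ≤ (inner ℂ v ((k : H →L[ℂ] H) v)).re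
      rw [hform]
      by_contra! h
      obtain ⟨z, hz, hpz, hkz⟩ := exists_inner_eq_zero (p : H →L[ℂ] H) k (hpv v) hpw h hpos
      exact hcon z hz hpz hkz
    exact mul_eq_zero_of_reTrace hτ hk0 ha (by rw [reTrace_mul_comm hτ, hak])

end Compression

/-! ### Numerical ranges and the spectral scale -/

section Ranges
variable {H : Type*} [NormedAddCommGroup H] [InnerProductSpace ℂ H] [CompleteSpace H]

open scoped ComplexOrder in
theorem numRange_subset_abstractNumRange (c : H →L[ℂ] H) : numRange c ⊆ abstractNumRange c := by
  rintro z ⟨v, hv, rfl⟩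
  let f : StarAlgebra.elemental ℂ c →ₗ[ℂ] ℂ :=
    { toFun := fun a => inner ℂ v ((a : H →L[ℂ] H) v)
      map_add' := fun a b => inner_add_right _ _ _
      map_smul' := fun r a => inner_smul_right _ _ _ }
  refine ⟨f, ⟨fun a => ?_, ?_⟩, rfl⟩
  · change 0 ≤ inner ℂ v ((star (a : H →L[ℂ] H)) ((a : H →L[ℂ] H) v))
    rw [ContinuousLinearMap.star_eq_adjoint, ContinuousLinearMap.adjoint_inner_right]
    rw [inner_self_eq_norm_sq_to_K]
    change (0 : ℂ) ≤ ((‖(a : H →L[ℂ] H) v‖ : ℝ) : ℂ) ^ 2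
    exact_mod_cast sq_nonneg ‖(a : H →L[ℂ] H) v‖
  · change inner ℂ v v = 1
    rw [inner_self_eq_norm_sq_to_K, hv]
    simp

open scoped ComplexOrder in
theorem convex_abstractNumRange (c : H →L[ℂ] H) : Convex ℝ (abstractNumRange c) := by
  rintro _ ⟨f, hf, rfl⟩ _ ⟨g, hg, rfl⟩ r s hr hs hrs
  refine ⟨(r : ℂ) • f + (s : ℂ) • g, ⟨fun a => ?_, ?_⟩, ?_⟩
  · have hr' : (0 : ℂ) ≤ r := by exact_mod_cast hr
    have hs' : (0 : ℂ) ≤ s := by exact_mod_cast hs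
    exact add_nonneg (mul_nonneg hr' (hf.nonneg a)) (mul_nonneg hs' (hg.nonneg a))
  · simp only [LinearMap.add_apply, LinearMap.smul_apply, hf.map_one, hg.map_one, smul_eq_mul,
      mul_one]
    exact_mod_cast hrs
  · simp

theorem convex_spectralScale (c : H →L[ℂ] H) (τ : (vonNeumann c).toStarSubalgebra →ₗ[ℂ] ℂ) :
    Convex ℝ (spectralScale c τ) := by
  rintro _ ⟨a, ha0, ha1, rfl⟩ _ ⟨b, hb0, hb1, rfl⟩ r s hr hs hrs
  refine ⟨(r : ℂ) • a + (s : ℂ) • b, ?_, ?_, ?_⟩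
  · exact add_nonneg (smul_nonneg_of_nonneg hr ha0) (smul_nonneg_of_nonneg hs hb0)
  · have h1 : r • (1 - (a : H →L[ℂ] H)) + s • (1 - (b : H →L[ℂ] H)) =
        1 - (((r : ℂ) • a + (s : ℂ) • b : (vonNeumann c).toStarSubalgebra) : H →L[ℂ] H) := by
      change _ = 1 - ((r : ℂ) • (a : H →L[ℂ] H) + (s : ℂ) • (b : H →L[ℂ] H))
      rw [Complex.coe_smul, Complex.coe_smul]
      obtain rfl : s = 1 - r := by linarith
      module
    rw [← sub_nonneg, ← h1]
    exact add_nonneg (smul_nonneg hr (sub_nonneg.2 ha1)) (smul_nonneg hs (sub_nonneg.2 hb1))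
  · ext <;> simp [add_mul]

theorem zero_mem_spectralScale (c : H →L[ℂ] H) (τ : (vonNeumann c).toStarSubalgebra →ₗ[ℂ] ℂ) :
    (0 : ℝ × ℂ) ∈ spectralScale c τ :=
  ⟨0, le_rfl, zero_le_one, by simp; rfl⟩

theorem fst_nonneg_of_mem_spectralScale {c : H →L[ℂ] H}
    {τ : (vonNeumann c).toStarSubalgebra →ₗ[ℂ] ℂ} (hτ : IsFaithfulNormalTracialState τ)
    {q : ℝ × ℂ} (hq : q ∈ spectralScale c τ) : 0 ≤ q.1 := by
  obtain ⟨a, ha, -, rfl⟩ := hq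
  exact reTrace_nonneg hτ ha

theorem eq_zero_of_mem_spectralScale {c : H →L[ℂ] H}
    {τ : (vonNeumann c).toStarSubalgebra →ₗ[ℂ] ℂ} (hτ : IsFaithfulNormalTracialState τ)
    {q : ℝ × ℂ} (hq : q ∈ spectralScale c τ) (h : q.1 = 0) : q = 0 := by
  obtain ⟨a, ha, -, rfl⟩ := hq
  obtain rfl := eq_zero_of_reTrace hτ ha h
  simp

end Ranges

/-! ### The spectral scale over a supporting line -/

section SupportingLine
variable {H : Type*} [NormedAddCommGroup H] [InnerProductSpace ℂ H] [CompleteSpace H]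
  {N : VonNeumannAlgebra H} {τ : N.toStarSubalgebra →ₗ[ℂ] ℂ}

/-- Every real functional on the plane is `z ↦ Re (w * z)`. -/
theorem exists_eq_re_mul (f : ℂ →ₗ[ℝ] ℝ) : ∃ w : ℂ, ∀ z, f z = (w * z).re := by
  refine ⟨⟨f 1, -f Complex.I⟩, fun z => ?_⟩
  have h : z = z.re • (1 : ℂ) + z.im • Complex.I := by simp
  conv_lhs => rw [h]
  simp only [map_add, map_smul, smul_eq_mul, Complex.mul_re]
  ring

/-- The real part `(x + x*) / 2` of an element. -/
noncomputable def hermPart (x : N.toStarSubalgebra) : N.toStarSubalgebra :=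
  (1 / 2 : ℂ) • (x + star x)

theorem star_hermPart (x : N.toStarSubalgebra) : star (hermPart x) = hermPart x := by
  rw [hermPart, star_smul, star_add, star_star, add_comm]
  simp

theorem reTrace_mul_hermPart (hτ : IsFaithfulNormalTracialState τ) {a : N.toStarSubalgebra}
    (ha : star a = a) (x : N.toStarSubalgebra) :
    reTrace τ (a * hermPart x) = (τ (a * x)).re := by
  have h1 : τ (a * star x) = star (τ (a * x)) := by
    rw [← hτ.isState.map_star, star_mul, ha, hτ.tracial]
  rw [reTrace_apply, hermPart, mul_smul_comm, mul_add, map_smul, map_add, h1]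
  simp
  ring

theorem inner_hermPart (x : N.toStarSubalgebra) (v : H) :
    (inner ℂ v ((hermPart x : H →L[ℂ] H) v)).re = (inner ℂ v ((x : H →L[ℂ] H) v)).re := by
  have h1 : (inner ℂ v ((star (x : H →L[ℂ] H)) v)).re = (inner ℂ v ((x : H →L[ℂ] H) v)).re := by
    rw [ContinuousLinearMap.star_eq_adjoint, ContinuousLinearMap.adjoint_inner_right]
    exact inner_re_symm (𝕜 := ℂ) _ _
  change (inner ℂ v ((1 / 2 : ℂ) • ((x : H →L[ℂ] H) v + (star (x : H →L[ℂ] H)) v))).re = _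
  rw [inner_smul_right, inner_add_right, show (1 / 2 : ℂ) = ((1 / 2 : ℝ) : ℂ) by norm_num,
    Complex.re_ofReal_mul, Complex.add_re, h1]
  ring

variable (c : H →L[ℂ] H)

/-- The operator `c` as an element of the von Neumann algebra that it generates. -/
noncomputable def gen : (vonNeumann c).toStarSubalgebra := ⟨c, self_mem_vonNeumann c⟩

/-- The deficit `u - Re (w c)`, which is nonnegative when the line `Re (w z) = u` supports the
numerical range. -/
noncomputable def deficit (w : ℂ) (u : ℝ) : (vonNeumann c).toStarSubalgebra :=
  u • 1 - hermPart (w • gen c)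

/-- The projection onto the eigenspace `Re (w c) = u`. -/
noncomputable def corner (w : ℂ) (u : ℝ) : (vonNeumann c).toStarSubalgebra :=
  ⟨kerProj (deficit c w u), kerProj_mem (deficit c w u).2⟩

/-- The compression of `Im (w c) - μ` to the range of `corner c w u`; here `Im (w c)` is written as
the real part of `-i w c`. -/
noncomputable def compressed (w : ℂ) (u μ : ℝ) : (vonNeumann c).toStarSubalgebra :=
  corner c w u * (hermPart ((-Complex.I * w) • gen c) - μ • 1) * corner c w u

theorem isStarProjection_corner (w : ℂ) (u : ℝ) :
    IsStarProjection (corner c w u : H →L[ℂ] H) := isStarProjection_kerProj _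

theorem star_corner (w : ℂ) (u : ℝ) : star (corner c w u) = corner c w u :=
  Subtype.ext (isStarProjection_corner c w u).isSelfAdjoint.star_eq

theorem corner_mul_self (w : ℂ) (u : ℝ) : corner c w u * corner c w u = corner c w u :=
  Subtype.ext (isStarProjection_corner c w u).isIdempotentElem

theorem star_compressed (w : ℂ) (u μ : ℝ) : star (compressed c w u μ) = compressed c w u μ := by
  rw [compressed, star_mul, star_mul, star_corner, star_sub, star_hermPart, star_smul, star_one,
    star_trivial, mul_assoc]

theorem compressed_mul_corner (w : ℂ) (u μ : ℝ) :
    compressed c w u μ * corner c w u = compressed c w u μ := by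
  rw [compressed, mul_assoc, corner_mul_self]

theorem star_deficit (w : ℂ) (u : ℝ) : star (deficit c w u) = deficit c w u := by
  rw [deficit, star_sub, star_hermPart, star_smul, star_one, star_trivial]

variable {c} {w : ℂ} {u : ℝ}

theorem inner_deficit (v : H) :
    (inner ℂ v ((deficit c w u : H →L[ℂ] H) v)).re = u * ‖v‖ ^ 2 - (w * inner ℂ v (c v)).re := by
  change (inner ℂ v (u • v - (hermPart (w • gen c) : H →L[ℂ] H) v)).re = _
  rw [inner_sub_right, Complex.sub_re, inner_hermPart, ← Complex.coe_smul, inner_smul_right,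
    Complex.re_ofReal_mul]
  change u * (inner ℂ v v : ℂ).re - (inner ℂ v (w • c v)).re = _
  rw [inner_smul_right, ← inner_self_eq_norm_sq (𝕜 := ℂ)]
  rfl

theorem inner_compressed {v : H} (μ : ℝ) (hv : (corner c w u : H →L[ℂ] H) v = v) :
    (inner ℂ v ((compressed c w u μ : H →L[ℂ] H) v)).re =
      (w * inner ℂ v (c v)).im - μ * ‖v‖ ^ 2 := by
  have h1 : star (corner c w u : H →L[ℂ] H) = corner c w u :=
    (isStarProjection_corner c w u).isSelfAdjoint.star_eq
  change (inner ℂ v ((corner c w u : H →L[ℂ] H)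
    (((hermPart ((-Complex.I * w) • gen c) - μ • 1 : (vonNeumann c).toStarSubalgebra) :
      H →L[ℂ] H) ((corner c w u : H →L[ℂ] H) v)))).re = _
  rw [hv, ← h1, ContinuousLinearMap.star_eq_adjoint, ContinuousLinearMap.adjoint_inner_right, hv]
  change (inner ℂ v ((hermPart ((-Complex.I * w) • gen c) : H →L[ℂ] H) v - μ • v)).re = _
  rw [inner_sub_right, Complex.sub_re, inner_hermPart, ← Complex.coe_smul, inner_smul_right,
    Complex.re_ofReal_mul]
  change (inner ℂ v ((-Complex.I * w) • c v)).re - μ * (inner ℂ v v : ℂ).re = _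
  rw [inner_smul_right, ← inner_self_eq_norm_sq (𝕜 := ℂ)]
  congr 1
  rw [mul_assoc]
  simp

theorem deficit_nonneg (hu : ∀ z ∈ numRange c, (w * z).re ≤ u) : 0 ≤ deficit c w u := by
  change (0 : H →L[ℂ] H) ≤ (deficit c w u : H →L[ℂ] H)
  rw [ContinuousLinearMap.nonneg_iff_isPositive, ContinuousLinearMap.isPositive_def']
  refine ⟨congrArg Subtype.val (star_deficit c w u), fun v => ?_⟩
  rw [ContinuousLinearMap.reApplyInnerSelf_apply, inner_re_symm]
  change 0 ≤ (inner ℂ v ((deficit c w u : H →L[ℂ] H) v)).re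
  rw [inner_deficit]
  rcases eq_or_ne v 0 with rfl | hv
  · simp
  have hn : 0 < ‖v‖ := norm_pos_iff.2 hv
  have h1 := hu _ ⟨((‖v‖⁻¹ : ℝ) : ℂ) • v, by
    rw [norm_smul, Complex.norm_real, norm_inv, norm_norm, inv_mul_cancel₀ hn.ne'], rfl⟩
  rw [map_smul, inner_smul_left, inner_smul_right, Complex.conj_ofReal, mul_left_comm,
    mul_left_comm w, Complex.re_ofReal_mul, Complex.re_ofReal_mul] at h1
  have h2 : ‖v‖ ^ 2 * (‖v‖⁻¹ * (‖v‖⁻¹ * (w * inner ℂ v (c v)).re)) = (w * inner ℂ v (c v)).re := by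
    field_simp
  have h3 := mul_le_mul_of_nonneg_left h1 (sq_nonneg ‖v‖)
  rw [h2] at h3
  linarith

/-- The numerical values on the supporting line come from the unit vectors in the corner. -/
theorem corner_apply_eq_self_iff (hu : ∀ z ∈ numRange c, (w * z).re ≤ u) {v : H} (hv : ‖v‖ = 1) :
    (corner c w u : H →L[ℂ] H) v = v ↔ (w * inner ℂ v (c v)).re = u := by
  have h1 := inner_deficit (c := c) (w := w) (u := u) v
  rw [hv, one_pow, mul_one] at h1
  refine kerProj_apply_eq_self_iff.trans ⟨fun h => ?_, fun h => ?_⟩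
  · rw [h, inner_zero_right, Complex.zero_re] at h1
    linarith
  · exact apply_eq_zero_of_nonneg (deficit_nonneg hu) (by rw [h1, h, sub_self])

variable {τ : (vonNeumann c).toStarSubalgebra →ₗ[ℂ] ℂ} (hτ : IsFaithfulNormalTracialState τ)
include hτ

theorem reTrace_mul_deficit {a : (vonNeumann c).toStarSubalgebra} (ha : star a = a) :
    reTrace τ (a * deficit c w u) = u * reTrace τ a - (w * τ (a * gen c)).re := by
  rw [deficit, mul_sub, map_sub, reTrace_mul_hermPart hτ ha, mul_smul_comm, mul_smul_comm, mul_one,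
    map_smul, map_smul]
  rfl

theorem reTrace_mul_compressed {a : (vonNeumann c).toStarSubalgebra} (ha : star a = a)
    (hac : a * corner c w u = a) (μ : ℝ) :
    reTrace τ (a * compressed c w u μ) = (w * τ (a * gen c)).im - μ * reTrace τ a := by
  have hca : corner c w u * a = a := by
    have := congrArg star hac
    rwa [star_mul, star_corner, ha] at this
  rw [compressed, ← mul_assoc, reTrace_mul_comm hτ, ← mul_assoc, ← mul_assoc, hca, hac, mul_sub,
    map_sub, reTrace_mul_hermPart hτ ha, mul_smul_comm, mul_smul_comm, mul_one,
    map_smul, map_smul, smul_eq_mul, smul_eq_mul, mul_assoc]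
  simp

/-- The points of the spectral scale over the supporting line come from the elements of the
corner. -/
theorem mul_corner_eq_self_iff (hu : ∀ z ∈ numRange c, (w * z).re ≤ u)
    {a : (vonNeumann c).toStarSubalgebra} (ha : 0 ≤ a) :
    a * corner c w u = a ↔ (w * τ (a * gen c)).re = u * reTrace τ a := by
  have ha' : (0 : H →L[ℂ] H) ≤ a := ha
  have has : star a = a := Subtype.ext ha'.isSelfAdjoint.star_eq
  have h1 : a * corner c w u = a ↔ deficit c w u * a = 0 := by
    rw [← star_inj, star_mul, star_corner, has, Subtype.ext_iff, Subtype.ext_iff]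
    exact kerProj_mul_eq_self_iff
  have h2 := reTrace_mul_deficit (w := w) (u := u) hτ has
  rw [h1]
  constructor
  · intro h
    rw [reTrace_mul_comm hτ, h, map_zero] at h2
    linarith
  · intro h
    refine mul_eq_zero_of_reTrace hτ (deficit_nonneg hu) ha ?_
    rw [reTrace_mul_comm hτ, h2, h, sub_self]

theorem le_of_mem_spectralScale (hu : ∀ z ∈ numRange c, (w * z).re ≤ u) {q : ℝ × ℂ}
    (hq : q ∈ spectralScale c τ) : (w * q.2).re ≤ u * q.1 := by
  obtain ⟨a, ha, -, rfl⟩ := hq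
  have h1 := reTrace_mul_nonneg hτ (x := a) ha (deficit_nonneg hu)
  rw [reTrace_mul_deficit hτ (Subtype.ext ha.isSelfAdjoint.star_eq)] at h1
  exact sub_nonneg.1 h1

/-- Slopes of the points of the spectral scale over the supporting line are numerical values of
`c`. -/
theorem mem_numRange_of_mem_spectralScale (hw : w ≠ 0) (hu : ∀ z ∈ numRange c, (w * z).re ≤ u)
    {t : ℝ} (ht : 0 < t) {lam : ℂ} (hlam : (w * lam).re = u)
    (hq : ((t, t * lam) : ℝ × ℂ) ∈ spectralScale c τ) : lam ∈ numRange c := by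
  obtain ⟨a, ha, -, hta⟩ := hq
  obtain ⟨h1, h2⟩ := Prod.mk_inj.1 hta
  change t = reTrace τ a at h1
  change t * lam = τ (a * gen c) at h2
  have has : star a = a := Subtype.ext ha.isSelfAdjoint.star_eq
  have ha0 : a ≠ 0 := by
    rintro rfl
    rw [map_zero] at h1
    exact ht.ne' h1
  have hac : a * corner c w u = a := (mul_corner_eq_self_iff hτ hu ha).2 (by
    rw [← h1, ← h2, mul_left_comm, Complex.re_ofReal_mul, hlam, mul_comm])
  obtain ⟨v, hv, hcv, hkv⟩ := exists_inner_eq_zero_of_reTrace hτ (star_corner c w u)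
    (corner_mul_self c w u) (star_compressed c w u (w * lam).im) (compressed_mul_corner c w u _)
    ha ha0 hac (by
      rw [reTrace_mul_compressed hτ has hac, ← h1, ← h2, mul_left_comm, Complex.im_ofReal_mul]
      ring)
  have hn : 0 < ‖v‖ := norm_pos_iff.2 hv
  let x : H := ((‖v‖⁻¹ : ℝ) : ℂ) • v
  have hx : ‖x‖ = 1 := by
    rw [norm_smul, Complex.norm_real, norm_inv, norm_norm, inv_mul_cancel₀ hn.ne']
  have hcx : (corner c w u : H →L[ℂ] H) x = x := by rw [map_smul, hcv]
  have hkx : (inner ℂ x ((compressed c w u (w * lam).im : H →L[ℂ] H) x)).re = 0 := by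
    rw [map_smul, inner_smul_left, inner_smul_right, Complex.conj_ofReal, Complex.re_ofReal_mul,
      Complex.re_ofReal_mul, hkv, mul_zero, mul_zero]
  rw [inner_compressed _ hcx, hx, one_pow, mul_one] at hkx
  refine ⟨x, hx, mul_left_cancel₀ hw (Complex.ext ?_ (sub_eq_zero.1 hkx))⟩
  rw [(corner_apply_eq_self_iff hu hx).1 hcx, hlam]

/-- In the direction of each numerical value on the supporting line, the spectral scale has a point
furthest from the origin. -/
theorem exists_isGreatest (hw : w ≠ 0) (hu : ∀ z ∈ numRange c, (w * z).re ≤ u) {lam : ℂ}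
    (hlam : lam ∈ numRange c) (hlamu : (w * lam).re = u) :
    ∃ T : ℝ, 0 < T ∧ IsGreatest {t : ℝ | ((t, t * lam) : ℝ × ℂ) ∈ spectralScale c τ} T := by
  obtain ⟨v, hv, rfl⟩ := hlam
  have hcv := (corner_apply_eq_self_iff hu hv).2 hlamu
  generalize hμ : (w * inner ℂ v (c v)).im = μ
  obtain ⟨a, ha⟩ := exists_isMaximizer hτ (isStarProjection_corner c w u)
    (star_compressed c w u μ) (compressed_mul_corner c w u μ)
    (v := v) (by rintro rfl; simp at hv) hcv (by
      rw [inner_compressed _ hcv, hμ, hv, one_pow, mul_one, sub_self])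
  have ha0 : (0 : H →L[ℂ] H) ≤ a := ha.nonneg
  have has : star a = a := Subtype.ext ha0.isSelfAdjoint.star_eq
  refine ⟨reTrace τ a, ha.pos, ⟨a, ha0, ha.le_one, Prod.ext rfl ?_⟩, ?_⟩
  · have h1 := (mul_corner_eq_self_iff hτ hu ha.nonneg).1 ha.mul_corner
    have h2 := ha.integral_eq
    rw [reTrace_mul_compressed hτ has ha.mul_corner] at h2
    change ((reTrace τ a : ℝ) : ℂ) * inner ℂ v (c v) = τ (a * gen c)
    refine mul_left_cancel₀ hw ?_
    rw [mul_left_comm]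
    apply Complex.ext
    · rw [Complex.re_ofReal_mul, hlamu, h1, mul_comm]
    · rw [Complex.im_ofReal_mul, hμ]
      linarith
  · rintro t ⟨b, hb0, hb1, htb⟩
    obtain ⟨h1, h2⟩ := Prod.mk_inj.1 htb
    change t = reTrace τ b at h1
    change t * inner ℂ v (c v) = τ (b * gen c) at h2
    have hbs : star b = b := Subtype.ext hb0.isSelfAdjoint.star_eq
    have hbc : b * corner c w u = b := (mul_corner_eq_self_iff hτ hu hb0).2 (by
      rw [← h1, ← h2, mul_left_comm, Complex.re_ofReal_mul, hlamu, mul_comm])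
    rw [h1]
    refine ha.max b hb0 hb1 hbc ?_
    rw [reTrace_mul_compressed hτ hbs hbc, ← h1, ← h2, mul_left_comm, Complex.im_ofReal_mul, hμ]
    ring

end SupportingLine

/-! ### Faces of the spectral scale at the origin -/

section Cone

/-- The functional `(t, z) ↦ f z - u * t`, which vanishes on the points whose slope lies on the line
`f = u`. -/
noncomputable def slopeForm (f : ℂ →ₗ[ℝ] ℝ) (u : ℝ) : ℝ × ℂ →ₗ[ℝ] ℝ :=
  f ∘ₗ LinearMap.snd ℝ ℝ ℂ - u • LinearMap.fst ℝ ℝ ℂ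

theorem slopeForm_apply (f : ℂ →ₗ[ℝ] ℝ) (u : ℝ) (q : ℝ × ℂ) :
    slopeForm f u q = f q.2 - u * q.1 := rfl

theorem slopeForm_radial {f : ℂ →ₗ[ℝ] ℝ} {u : ℝ} (t : ℝ) {lam : ℂ} (h : f lam = u) :
    slopeForm f u (t, t * lam) = 0 := by
  rw [slopeForm_apply, ← Complex.real_smul, map_smul, h, smul_eq_mul]
  ring

theorem finrank_ker_slopeForm {f : ℂ →ₗ[ℝ] ℝ} (hf : f ≠ 0) (u : ℝ) :
    Module.finrank ℝ (LinearMap.ker (slopeForm f u)) = 2 := by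
  have h1 : slopeForm f u ≠ 0 := by
    intro h
    refine hf (LinearMap.ext fun z => ?_)
    have := LinearMap.congr_fun h (0, z)
    simpa [slopeForm_apply] using this
  have h2 := Module.Dual.finrank_ker_add_one_of_ne_zero h1
  rw [Module.finrank_prod, Complex.finrank_real_complex, Module.finrank_self] at h2
  omega

theorem two_le_affineDim {E : Set (ℝ × ℂ)} (h0 : 0 ∈ E) {s t : ℝ} (hs : s ≠ 0) (ht : t ≠ 0)
    {x y : ℂ} (hxy : x ≠ y) (hx : (s, s * x) ∈ E) (hy : (t, t * y) ∈ E) : 2 ≤ affineDim E := by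
  have hli : LinearIndependent ℝ ![((s, s * x) : ℝ × ℂ), (t, t * y)] := by
    rw [LinearIndependent.pair_iff]
    intro a b hab
    have h1 : a * s + b * t = 0 := by simpa using congrArg Prod.fst hab
    have h2 : (a : ℂ) * (s * x) + b * (t * y) = 0 := by simpa using congrArg Prod.snd hab
    have h3 : (b : ℂ) * t = -(a * s) := by
      rw [eq_neg_iff_add_eq_zero, add_comm]
      exact_mod_cast h1
    have h4 : (a : ℂ) * s * (x - y) = 0 := by
      rw [← mul_assoc (b : ℂ), h3] at h2
      linear_combination h2
    have h5 : (a : ℂ) * s = 0 := (mul_eq_zero.1 h4).resolve_right (sub_ne_zero.2 hxy)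
    have h6 : a * s = 0 := by exact_mod_cast h5
    refine ⟨(mul_eq_zero.1 h6).resolve_right hs, ?_⟩
    rw [h6, zero_add] at h1
    exact (mul_eq_zero.1 h1).resolve_right ht
  have h1 := finrank_span_eq_card hli
  rw [Fintype.card_fin] at h1
  refine h1.ge.trans ?_
  refine Submodule.finrank_mono (Submodule.span_le.2 ?_)
  rintro _ ⟨i, rfl⟩
  fin_cases i
  · simpa using vsub_mem_vectorSpan ℝ hx h0
  · simpa using vsub_mem_vectorSpan ℝ hy h0

theorem affineDim_le_one_of_slope {E : Set (ℝ × ℂ)} {lam : ℂ}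
    (h : ∀ q ∈ E, ∃ t : ℝ, q = (t, t * lam)) : affineDim E ≤ 1 := by
  have h1 : vectorSpan ℝ E ≤ Submodule.span ℝ {((1, lam) : ℝ × ℂ)} := by
    rw [vectorSpan, Submodule.span_le]
    rintro _ ⟨p, hp, q, hq, rfl⟩
    obtain ⟨s, rfl⟩ := h p hp
    obtain ⟨t, rfl⟩ := h q hq
    refine Submodule.mem_span_singleton.2 ⟨s - t, ?_⟩
    ext <;> simp [sub_mul]
  exact (Submodule.finrank_mono h1).trans
    (finrank_span_singleton fun h => one_ne_zero (congrArg Prod.fst h)).le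

/-- The convex geometry of the theorem. The only possible face is the part of `B` lying over the
supporting line `f = u`: the slope condition puts a face inside it, and a face of full dimension is
all of it. -/
theorem faces_over_supporting_line {B : Set (ℝ × ℂ)} {f : ℂ →ₗ[ℝ] ℝ} {u : ℝ} {FW : Set ℂ}
    (hB : Convex ℝ B) (h0 : 0 ∈ B) (hfst : ∀ q ∈ B, 0 ≤ q.1) (hzero : ∀ q ∈ B, q.1 = 0 → q = 0)
    (hf : f ≠ 0) (hle : ∀ q ∈ B, f q.2 ≤ u * q.1) (hFW : ∀ lam ∈ FW, f lam = u)
    (hslope : ∀ (t : ℝ) (lam : ℂ), 0 < t → (t, t * lam) ∈ B → f lam = u → lam ∈ FW)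
    (hmax : ∀ lam ∈ FW, ∃ T : ℝ, 0 < T ∧ IsGreatest {t : ℝ | (t, (t : ℂ) * lam) ∈ B} T) :
    ((∃ x ∈ FW, ∃ y ∈ FW, x ≠ y) ↔
      ∃ FB : Set (ℝ × ℂ), IsFace B FB ∧ affineDim FB = 2 ∧ 0 ∈ FB ∧
        ∀ S : Set (ℝ × ℂ), IsLineSegment S → S ⊆ FB → 0 ∈ S →
          ∃ lam ∈ FW, ∃ s : ℝ, 0 < s ∧ S = radialSegment lam s) ∧
    (∀ FB : Set (ℝ × ℂ), IsFace B FB → affineDim FB = 2 → 0 ∈ FB →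
      (∀ S : Set (ℝ × ℂ), IsLineSegment S → S ⊆ FB → 0 ∈ S →
        ∃ lam ∈ FW, ∃ s : ℝ, 0 < s ∧ S = radialSegment lam s) →
      ∃ T : ℂ → ℝ,
        (∀ lam ∈ FW, 0 < T lam ∧ IsGreatest {t : ℝ | (t, (t : ℂ) * lam) ∈ B} (T lam)) ∧
        ∀ S : Set (ℝ × ℂ), (IsLineSegment S ∧ S ⊆ FB ∧ 0 ∈ S) ↔
          ∃ lam ∈ FW, ∃ s : ℝ, 0 < s ∧ s ≤ T lam ∧ S = radialSegment lam s) := by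
  let E : Set (ℝ × ℂ) := {q ∈ B | slopeForm f u q = 0}
  have hE : IsFace B E := isFace_inter_level hB (slopeForm f u) fun q hq =>
    sub_nonpos.2 (hle q hq)
  have h0E : 0 ∈ E := ⟨h0, map_zero _⟩
  have hEdim : affineDim E ≤ 2 := by
    rw [← finrank_ker_slopeForm hf u]
    exact Submodule.finrank_mono (vectorSpan_le_ker (slopeForm f u) fun q (hq : q ∈ E) => hq.2)
  have hEseg : ∀ S : Set (ℝ × ℂ), IsLineSegment S → S ⊆ E → 0 ∈ S →
      ∃ lam ∈ FW, ∃ s : ℝ, 0 < s ∧ S = radialSegment lam s := by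
    intro S hS hSE hS0
    obtain ⟨lam, s, hs, rfl⟩ := exists_eq_radialSegment hfst hzero hS
      (hSE.trans fun q hq => hq.1) hS0
    obtain ⟨h1, h2⟩ := hSE (mem_radialSegment_end lam hs)
    refine ⟨lam, hslope s lam hs h1 ?_, s, hs, rfl⟩
    rw [slopeForm_apply, ← Complex.real_smul, map_smul, smul_eq_mul, mul_comm u, ← mul_sub] at h2
    exact sub_eq_zero.1 ((mul_eq_zero.1 h2).resolve_left hs.ne')
  have hpoint : ∀ FB : Set (ℝ × ℂ), IsFace B FB → 0 ∈ FB →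
      (∀ S : Set (ℝ × ℂ), IsLineSegment S → S ⊆ FB → 0 ∈ S →
        ∃ lam ∈ FW, ∃ s : ℝ, 0 < s ∧ S = radialSegment lam s) →
      ∀ q ∈ FB, q ≠ 0 → ∃ lam ∈ FW, ∃ t : ℝ, q = (t, t * lam) := by
    intro FB hFB hFB0 hseg q hq hq0
    obtain ⟨lam, hlam, s, -, hS⟩ := hseg (segment ℝ 0 q) ⟨0, q, hq0.symm, rfl⟩
      (hFB.1.segment_subset hFB0 hq) (left_mem_segment ℝ 0 q)
    have h1 : q ∈ radialSegment lam s := hS ▸ right_mem_segment ℝ 0 q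
    obtain ⟨t, -, -, rfl⟩ := h1
    exact ⟨lam, hlam, t, rfl⟩
  have heq : ∀ FB : Set (ℝ × ℂ), IsFace B FB → affineDim FB = 2 → 0 ∈ FB →
      (∀ S : Set (ℝ × ℂ), IsLineSegment S → S ⊆ FB → 0 ∈ S →
        ∃ lam ∈ FW, ∃ s : ℝ, 0 < s ∧ S = radialSegment lam s) → FB = E := by
    intro FB hFB hdim hFB0 hseg
    have hsub : FB ⊆ E := by
      intro q hq
      rcases eq_or_ne q 0 with rfl | hq0
      · exact h0E
      obtain ⟨lam, hlam, t, rfl⟩ := hpoint FB hFB hFB0 hseg q hq hq0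
      exact ⟨hFB.2.1 hq, slopeForm_radial t (hFW lam hlam)⟩
    exact (hFB.mono hE.2.1 hsub).eq_of_affineDim_le ⟨0, hFB0⟩ (hdim ▸ hEdim)
  refine ⟨⟨?_, ?_⟩, fun FB hFB hdim hFB0 hseg => ?_⟩
  · rintro ⟨x, hx, y, hy, hxy⟩
    obtain ⟨s, hs, hsx, -⟩ := hmax x hx
    obtain ⟨t, ht, hty, -⟩ := hmax y hy
    refine ⟨E, hE, le_antisymm hEdim ?_, h0E, hEseg⟩
    exact two_le_affineDim h0E hs.ne' ht.ne' hxy ⟨hsx, slopeForm_radial s (hFW x hx)⟩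
      ⟨hty, slopeForm_radial t (hFW y hy)⟩
  · rintro ⟨FB, hFB, hdim, hFB0, hseg⟩
    by_contra! hall
    obtain ⟨p, hp, hp0⟩ : ∃ p ∈ FB, p ≠ 0 := by
      by_contra! hcon
      obtain ⟨x, hx, y, hy, hxy⟩ := affineDim_ne_zero_iff.1 (hdim ▸ two_ne_zero)
      exact hxy ((hcon x hx).trans (hcon y hy).symm)
    obtain ⟨lam, hlam, -⟩ := hpoint FB hFB hFB0 hseg p hp hp0
    have h1 : affineDim FB ≤ 1 := affineDim_le_one_of_slope (lam := lam) fun q hq => by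
      rcases eq_or_ne q 0 with rfl | hq0
      · exact ⟨0, by simp; rfl⟩
      obtain ⟨lam', hlam', t, rfl⟩ := hpoint FB hFB hFB0 hseg q hq hq0
      exact ⟨t, by rw [hall lam hlam lam' hlam']⟩
    omega
  · choose! T hT using hmax
    refine ⟨T, hT, fun S => ⟨?_, ?_⟩⟩
    · rintro ⟨hS, hSFB, hS0⟩
      obtain ⟨lam, hlam, s, hs, rfl⟩ := hseg S hS hSFB hS0
      exact ⟨lam, hlam, s, hs, (hT lam hlam).2.2 (hFB.2.1 (hSFB (mem_radialSegment_end lam hs))),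
        rfl⟩
    · rintro ⟨lam, hlam, s, hs, hsT, rfl⟩
      refine ⟨isLineSegment_radialSegment lam hs, ?_, zero_mem_radialSegment lam hs⟩
      rw [heq FB hFB hdim hFB0 hseg]
      have h1 : radialSegment lam s ⊆ radialSegment lam (T lam) :=
        fun q ⟨t, ht0, hts, hq⟩ => ⟨t, ht0, hts.trans hsT, hq⟩
      refine h1.trans ?_
      rw [radialSegment_eq lam (hT lam hlam).1]
      exact hE.1.segment_subset h0E ⟨(hT lam hlam).2.1, slopeForm_radial _ (hFW lam hlam)⟩

end Cone
end SpectralScale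

theorem theorem2p8 {H : Type*} [NormedAddCommGroup H] [InnerProductSpace ℂ H] [CompleteSpace H]
    [TopologicalSpace.SeparableSpace H] (hH : ¬ FiniteDimensional ℂ H)
    (c : H →L[ℂ] H)
    (τ : (SpectralScale.vonNeumann c).toStarSubalgebra →ₗ[ℂ] ℂ)
    (hτ : SpectralScale.IsFaithfulNormalTracialState τ)
    (Fab : Set ℂ)
    (hface : SpectralScale.IsFace (SpectralScale.abstractNumRange c) Fab)
    (hproper : Fab ≠ SpectralScale.abstractNumRange c)
    (hdim : SpectralScale.affineDim Fab = 1)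
    (FW : Set ℂ) (hFW : FW = Fab ∩ SpectralScale.numRange c) :
    (SpectralScale.affineDim FW = 1 ↔
      ∃ FB : Set (ℝ × ℂ), SpectralScale.IsFace (SpectralScale.spectralScale c τ) FB ∧
        SpectralScale.affineDim FB = 2 ∧ 0 ∈ FB ∧
        ∀ S : Set (ℝ × ℂ), SpectralScale.IsLineSegment S → S ⊆ FB → 0 ∈ S →
          ∃ lam ∈ FW, ∃ s : ℝ, 0 < s ∧ S = SpectralScale.radialSegment lam s) ∧
    (∀ FB : Set (ℝ × ℂ), SpectralScale.IsFace (SpectralScale.spectralScale c τ) FB →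
      SpectralScale.affineDim FB = 2 → 0 ∈ FB →
      (∀ S : Set (ℝ × ℂ), SpectralScale.IsLineSegment S → S ⊆ FB → 0 ∈ S →
        ∃ lam ∈ FW, ∃ s : ℝ, 0 < s ∧ S = SpectralScale.radialSegment lam s) →
      ∃ T : ℂ → ℝ,
        (∀ lam ∈ FW, 0 < T lam ∧
          IsGreatest {t : ℝ | (t, (t : ℂ) * lam) ∈ SpectralScale.spectralScale c τ} (T lam)) ∧
        ∀ S : Set (ℝ × ℂ),
          (SpectralScale.IsLineSegment S ∧ S ⊆ FB ∧ 0 ∈ S) ↔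
            ∃ lam ∈ FW, ∃ s : ℝ, 0 < s ∧ s ≤ T lam ∧
              S = SpectralScale.radialSegment lam s) := by
  open SpectralScale in
  have hFWdim : affineDim FW = 1 ↔ ∃ x ∈ FW, ∃ y ∈ FW, x ≠ y := by
    rw [← affineDim_ne_zero_iff]
    have h1 : affineDim FW ≤ affineDim Fab :=
      Submodule.finrank_mono (vectorSpan_mono ℝ (hFW ▸ Set.inter_subset_left))
    omega
  obtain ⟨f, u, hf, hle, rfl⟩ :=
    hface.exists_supporting_line (convex_abstractNumRange c) hproper hdim
  obtain ⟨w, hw⟩ := exists_eq_re_mul f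
  have hw0 : w ≠ 0 := by
    rintro rfl
    exact hf (LinearMap.ext fun z => by simp [hw])
  have hu : ∀ z ∈ numRange c, (w * z).re ≤ u := fun z hz =>
    (hw z).symm.trans_le (hle z (numRange_subset_abstractNumRange c hz))
  subst hFW
  rw [hFWdim]
  refine faces_over_supporting_line (convex_spectralScale c τ) (zero_mem_spectralScale c τ)
    (fun q => fst_nonneg_of_mem_spectralScale hτ) (fun q => eq_zero_of_mem_spectralScale hτ) hf
    (fun q hq => (hw q.2).trans_le (le_of_mem_spectralScale hτ hu hq)) (fun lam h => h.1.2)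
    (fun t lam ht hq hlam => ?_)
    (fun lam h => exists_isGreatest hτ hw0 hu h.2 ((hw lam).symm.trans h.1.2))
  have h1 := mem_numRange_of_mem_spectralScale hτ hw0 hu ht ((hw lam).symm.trans hlam) hq
  exact ⟨⟨numRange_subset_abstractNumRange c h1, hlam⟩, h1⟩
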